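/- \textbf{Setting.} A sequence $f=\{f(x)\}_{x\in\mathbf Z^2}$ with values in $\mathbf C^4$ has components $f_p$, $p\in\{\leftarrow,\rightarrow,\downarrow,\uparrow\}$, and $\mathbf e_\leftarrow,\mathbf e_\rightarrow,\mathbf e_\downarrow,\mathbf e_\uparrow$ is the standard basis of $\mathbf C^4$. The shift is $$(Sf)(x)=[f_\leftarrow(x+e_1),f_\rightarrow(x-e_1),f_\downarrow(x+e_2),f_\uparrow(x-e_2)]^{\mathsf T}.$$ Let $C(x)\in\mathrm U(4)$, $x\in\mathbf Z^2$, and let $n_0\ge 1$ be an integer such that $C(x)=I_4$ for $x\notin D:=\{x:|x_1|\le n_0,|x_2|\le n_0\}$, and such that for every $x\in D$ the $2\times2$ minor of $C(x)$ with rows and columns $\leftarrow,\downarrow$ and the $2\times 2$ minor with rows and columns $\rightarrow,\uparrow$ are nonzero. Put $U_0=S$, $U=SC$, $V=U-U_0$, $V^*=(C^*-1)S^{-1}$, and, on $\ell^2(\mathbf Z^2;\mathbf C^4)$, $R(\kappa)=(U-e^{i\kappa})^{-1}$ for $\kappa\in\mathbf C\setminus\mathbf R$. Let $r_{-1}=0$,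 $r_j=2^j$, $I_j=\{y\in\mathbf Z: r_{j-1}\le|y|<r_j\}$ and $$a_j(f)^2=\sum_{p\in\{\leftarrow,\rightarrow\}}\sum_{x_1\in I_j,\,x_2\in\mathbf Z}|f_p(x)|^2+\sum_{p\in\{\downarrow,\uparrow\}}\sum_{x_2\in I_j,\,x_1\in\mathbf Z}|f_p(x)|^2 ,$$ $\mathcal B=\{f:\sum_j r_j^{1/2}a_j(f)<\infty\}$, $\mathcal B^*=\{u:\sup_j r_j^{-1/2}a_j(u)<\infty\}$, with the pairing $(u,f)=\sum_x\sum_p u_p(x)\overline{f_p(x)}$. Let $R(\theta\pm i0)f\in\mathcal B^*$ be the weak-$*$ limit of $R(\theta-i\log(1\mp\epsilon))f$ as $\epsilon\downarrow0$. Let $\mathbf h(\theta)=\bigoplus_p\ell^2(\mathbf Z;\mathbf C)\mathbf e_p$ and $$(\mathcal F^{(0)}_p(\theta)f)(x_2)=\tfrac1{\sqrt{2\pi}}\sum_{y_1\in\mathbf Z}e^{\mp i\theta y_1}f_p(y_1,x_2)\quad (p=\leftarrow \text{ for } -,\ p=\rightarrow \text{ for } +),$$ $$(\mathcal F^{(0)}_p(\theta)f)(x_1)=\tfrac1{\sqrt{2\pi}}\sum_{y_2\in\mathbf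 Z}e^{\mp i\theta y_2}f_p(x_1,y_2)\quad (p=\downarrow \text{ for } -,\ p=\uparrow \text{ for } +),$$ $\mathcal F^{(\pm)}_p(\theta)=\mathcal F^{(0)}_p(\theta)(1-VR(\theta\pm i0))$. For an operator $\mathcal F=(\mathcal F_p)_p$ from $\mathcal B$ to $\mathbf h(\theta)$ the adjoint is given by $(\mathcal F^*\phi)_p(x)=(\phi,\mathcal F(\delta_x\mathbf e_p))_{\mathbf h(\theta)}$, where $\delta_x$ is the indicator of $\{x\}$. Finally $$A(\theta)=(A_\leftarrow(\theta),A_\rightarrow(\theta),A_\downarrow(\theta),A_\uparrow(\theta)),\qquad A_p(\theta)=\mathcal F^{(-)}_p(\theta)V^*\mathcal F^{(0)}(\theta)^* ,$$ and for $\phi\in\mathbf h(\theta)$ the scattered wave is $v^{(+)}=\mathcal F^{(+)}(\theta)^*\phi-\mathcal F^{(0)}(\theta)^*\phi$. \textbf{Theorem.} Let $\theta\in[0,2\pi)$. The limits $R(\theta\pm i0)f$ exist for all finitely supported $f$ (these are the only $f$ to which they are applied below), and the following hold. 1. For every $\phi\in\mathbf h(\theta)$, $(A_\leftarrow(\theta)\phi)(x_2)=(A_\rightarrow(\theta)\phi)(x_2)=0$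 for $|x_2|\ge n_0+1$. 2. For every $\phi\in\mathbf h(\theta)$, $(A_\downarrow(\theta)\phi)(x_1)=(A_\uparrow(\theta)\phi)(x_1)=0$ for $|x_1|\ge n_0+1$. 3. $A(\theta)$ is a bounded linear operator of finite rank on $\mathbf h(\theta)$. 4. The scattered wave travels only along corridors: for every $\phi\in\mathbf h(\theta)$, $v^{(+)}_\leftarrow(x)=v^{(+)}_\rightarrow(x)=0$ if $|x_2|\ge n_0+1$, $v^{(+)}_\downarrow(x)=v^{(+)}_\uparrow(x)=0$ if $|x_1|\ge n_0+1$, and $$v^{(+)}_\leftarrow(x)=-\sqrt{2\pi}\,e^{i\theta}e^{i\theta x_1}(A_\leftarrow(\theta)\phi)(x_2)\ \ (x_1\le -n_0-1),\qquad v^{(+)}_\rightarrow(x)=-\sqrt{2\pi}\,e^{i\theta}e^{-i\theta x_1}(A_\rightarrow(\theta)\phi)(x_2)\ \ (x_1\ge n_0+1),$$ $$v^{(+)}_\downarrow(x)=-\sqrt{2\pi}\,e^{i\theta}e^{i\theta x_2}(A_\downarrow(\theta)\phi)(x_1)\ \ (x_2\le -n_0-1),\qquad v^{(+)}_\uparrow(x)=-\sqrt{2\pi}\,e^{i\theta}e^{-i\theta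 x_2}(A_\uparrow(\theta)\phi)(x_1)\ \ (x_2\ge n_0+1).$$ -/

import Mathlib

open scoped ENNReal Topology ComplexConjugate
open Filter

noncomputable section

namespace QWalk

/-- The four chiralities `←`, `→`, `↓`, `↑` of the two-dimensional walk. -/
inductive Chirality : Type
  | left | right | down | up
  deriving DecidableEq

instance : Fintype Chirality :=
  ⟨{Chirality.left, Chirality.right, Chirality.down, Chirality.up}, by intro x; cases x <;> decide⟩

namespace Chirality

/-- `1` for `←`, `↓` and `-1` for `→`, `↑`. -/
def sgn : Chirality → ℤ
  | left => 1
  | right => -1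
  | down => 1
  | up => -1

/-- The shift operator reads the component of chirality `p` at `x + p.step`. -/
def step : Chirality → ℤ × ℤ
  | left => (1, 0)
  | right => (-1, 0)
  | down => (0, 1)
  | up => (0, -1)

/-- The coordinate of a site along the direction of motion: `x₁` for `←`, `→`, and `x₂` for
`↓`, `↑`. -/
def along : Chirality → ℤ × ℤ → ℤ
  | left, x => x.1
  | right, x => x.1
  | down, x => x.2
  | up, x => x.2

/-- The other coordinate of a site: `x₂` for `←`, `→`, and `x₁` for `↓`, `↑`. -/
def across : Chirality → ℤ × ℤ → ℤ
  | left, x => x.2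
  | right, x => x.2
  | down, x => x.1
  | up, x => x.1

/-- The site whose coordinate along the direction of motion is `t` and whose other coordinate
is `y`. -/
def site : Chirality → ℤ → ℤ → ℤ × ℤ
  | left, t, y => (t, y)
  | right, t, y => (t, y)
  | down, t, y => (y, t)
  | up, t, y => (y, t)

end Chirality

/-- `ℂ⁴`-valued sequences on `ℤ²`: `f (p, x)` is the component `f_p(x)`. -/
abbrev Seq : Type := Chirality × (ℤ × ℤ) → ℂ

/-- The Hilbert space `ℓ²(ℤ²; ℂ⁴)`. -/
abbrev L2 : Type := lp (fun _ : Chirality × (ℤ × ℤ) => ℂ) 2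

/-- The Hilbert space `𝐡(θ) = ⨁_p ℓ²(ℤ; ℂ) 𝐞_p`; `φ (p, y)` is the component `φ_p(y)`. -/
abbrev HSpace : Type := lp (fun _ : Chirality × ℤ => ℂ) 2

/-- A field of unitary `4 × 4` coin matrices `C(x)`, `x ∈ ℤ²`. -/
abbrev Coin : Type := ℤ × ℤ → Matrix.unitaryGroup Chirality ℂ

/-- The square `D = {x ∈ ℤ² : |x₁| ≤ n₀, |x₂| ≤ n₀}`. -/
def box (n₀ : ℕ) : Set (ℤ × ℤ) := {x | |x.1| ≤ n₀ ∧ |x.2| ≤ n₀}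

/-- The standing assumptions on the coin: it is the identity off the square `D`, and on `D` the
two `2 × 2` minors on the chiralities `←`, `↓` and on the chiralities `→`, `↑` do not vanish. -/
structure Coin.Admissible (C : Coin) (n₀ : ℕ) : Prop where
  eq_one : ∀ x, x ∉ box n₀ → C x = 1
  det_odd : ∀ x ∈ box n₀,
    ((C x : Matrix Chirality Chirality ℂ).submatrix
      ![Chirality.left, Chirality.down] ![Chirality.left, Chirality.down]).det ≠ 0
  det_even : ∀ x ∈ box n₀,
    ((C x : Matrix Chirality Chirality ℂ).submatrix
      ![Chirality.right, Chirality.up] ![Chirality.right, Chirality.up]).det ≠ 0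

/-! ### The walk on sequences -/

/-- The shift operator `S`, which is also the free walk `U₀`. -/
def shift (f : Seq) : Seq := fun a => f (a.1, a.2 + a.1.step)

/-- The inverse shift `S⁻¹ = U₀^*`. -/
def shiftInv (f : Seq) : Seq := fun a => f (a.1, a.2 - a.1.step)

/-- Multiplication by `C(x)`. -/
def coinMul (C : Coin) (f : Seq) : Seq :=
  fun a => ∑ q, (C a.2 : Matrix Chirality Chirality ℂ) a.1 q * f (q, a.2)

/-- Multiplication by the adjoint matrix `C(x)^*`. -/
def coinAdjMul (C : Coin) (f : Seq) : Seq :=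
  fun a => ∑ q, conj ((C a.2 : Matrix Chirality Chirality ℂ) q a.1) * f (q, a.2)

/-- The position-dependent walk `U = S C`. -/
def walk (C : Coin) (f : Seq) : Seq := shift (coinMul C f)

/-- The perturbation `V = U - U₀`. -/
def pert (C : Coin) (f : Seq) : Seq := walk C f - shift f

/-- `V^* = U^* - U₀^*`, where `U^* = C^* S⁻¹` and `U₀^* = S⁻¹`. -/
def pertAdj (C : Coin) (f : Seq) : Seq := coinAdjMul C (shiftInv f) - shiftInv f

/-! ### The walk and its resolvent on `ℓ²` -/

theorem memL2_iff {ι : Type} (f : ι → ℂ) : Memℓp f 2 ↔ Summable fun a => ‖f a‖ ^ 2 := by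
  rw [memℓp_gen_iff (by norm_num)]
  simp

theorem sum_normSq_coin (M : Matrix.unitaryGroup Chirality ℂ) (v : Chirality → ℂ) :
    ∑ p, ‖∑ q, (M : Matrix Chirality Chirality ℂ) p q * v q‖ ^ 2 = ∑ p, ‖v p‖ ^ 2 := by
  have key : ∀ w : Chirality → ℂ, ((∑ p, ‖w p‖ ^ 2 : ℝ) : ℂ) = star w ⬝ᵥ w := by
    intro w
    simp [dotProduct, Complex.conj_mul']
  have h : star ((M : Matrix Chirality Chirality ℂ).mulVec v) ⬝ᵥ
      ((M : Matrix Chirality Chirality ℂ).mulVec v) = star v ⬝ᵥ v := by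
    have hM : (M : Matrix Chirality Chirality ℂ).conjTranspose * M = 1 :=
      Matrix.mem_unitaryGroup_iff'.mp M.2
    rw [Matrix.star_mulVec, Matrix.dotProduct_mulVec, Matrix.vecMul_vecMul, hM, Matrix.vecMul_one]
  rw [← key, ← key] at h
  exact_mod_cast h

theorem summable_coinMul (C : Coin) {f : Seq} (hf : Summable fun a => ‖f a‖ ^ 2) :
    Summable (fun a => ‖coinMul C f a‖ ^ 2) := by
  have hq : ∀ q, Summable fun x => ‖f (q, x)‖ ^ 2 :=
    ((summable_prod_of_nonneg fun _ => by positivity).mp hf).1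
  rw [summable_prod_of_nonneg fun _ => by positivity]
  refine ⟨fun p => ?_, Summable.of_finite⟩
  refine Summable.of_nonneg_of_le (fun _ => by positivity) (fun x => ?_)
    (summable_sum (s := Finset.univ) fun q _ => hq q)
  have h := sum_normSq_coin (C x) (fun q => f (q, x))
  rw [← h]
  exact Finset.single_le_sum
    (f := fun p => ‖∑ q, (C x : Matrix Chirality Chirality ℂ) p q * f (q, x)‖ ^ 2)
    (fun _ _ => by positivity) (Finset.mem_univ p)

theorem tsum_coinMul (C : Coin) {f : Seq} (hf : Summable fun a => ‖f a‖ ^ 2) :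
    ∑' a, ‖coinMul C f a‖ ^ 2 = ∑' a, ‖f a‖ ^ 2 := by
  have hC := summable_coinMul C hf
  have hq : ∀ q, Summable fun x => ‖f (q, x)‖ ^ 2 :=
    ((summable_prod_of_nonneg fun _ => by positivity).mp hf).1
  have hCq : ∀ q, Summable fun x => ‖coinMul C f (q, x)‖ ^ 2 :=
    ((summable_prod_of_nonneg fun _ => by positivity).mp hC).1
  rw [hf.tsum_prod' hq, hC.tsum_prod' hCq, tsum_fintype, tsum_fintype,
    ← Summable.tsum_finsetSum fun q _ => hq q, ← Summable.tsum_finsetSum fun q _ => hCq q]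
  exact tsum_congr fun x => sum_normSq_coin (C x) (fun q => f (q, x))

/-- The permutation of `Chirality × ℤ²` by which the shift operator acts. -/
def shiftEquiv : Chirality × (ℤ × ℤ) ≃ Chirality × (ℤ × ℤ) where
  toFun a := (a.1, a.2 + a.1.step)
  invFun a := (a.1, a.2 - a.1.step)
  left_inv a := by simp
  right_inv a := by simp

theorem summable_walk (C : Coin) {f : Seq} (hf : Summable fun a => ‖f a‖ ^ 2) :
    Summable (fun a => ‖walk C f a‖ ^ 2) :=
  (shiftEquiv.summable_iff (f := fun a => ‖coinMul C f a‖ ^ 2)).mpr (summable_coinMul C hf)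

theorem tsum_walk (C : Coin) {f : Seq} (hf : Summable fun a => ‖f a‖ ^ 2) :
    ∑' a, ‖walk C f a‖ ^ 2 = ∑' a, ‖f a‖ ^ 2 :=
  (shiftEquiv.tsum_eq (fun a => ‖coinMul C f a‖ ^ 2)).trans (tsum_coinMul C hf)

/-- The walk `U = S C` as a bounded operator on `ℓ²`. -/
def walkL2 (C : Coin) : L2 →L[ℂ] L2 :=
  LinearMap.mkContinuous
    { toFun := fun f => ⟨walk C f, (memL2_iff _).mpr
        (summable_walk C ((memL2_iff _).mp (lp.memℓp f)))⟩
      map_add' := fun f g => by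
        ext a
        change walk C (⇑f + ⇑g) a = walk C f a + walk C g a
        simp [walk, shift, coinMul, mul_add, Finset.sum_add_distrib]
      map_smul' := fun c f => by
        ext a
        change walk C (c • ⇑f) a = c * walk C f a
        simp [walk, shift, coinMul, Finset.mul_sum, mul_left_comm] }
    1 fun f => by
      have hn : ∀ g : L2, ‖g‖ ^ 2 = ∑' a, ‖g a‖ ^ 2 := fun g => by
        have := lp.norm_rpow_eq_tsum (p := 2) (by norm_num) g
        simpa using this
      rw [one_mul, ← sq_le_sq₀ (norm_nonneg _) (norm_nonneg _), hn, hn]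
      exact (tsum_walk C ((memL2_iff _).mp (lp.memℓp f))).le

/-- The resolvent `R(κ) = (U - e^{iκ})⁻¹` in the algebra of bounded operators on `ℓ²`. -/
def resolventL2 (C : Coin) (κ : ℂ) : L2 →L[ℂ] L2 :=
  Ring.inverse (walkL2 C - Complex.exp (Complex.I * κ) • (1 : L2 →L[ℂ] L2))

open Classical in
/-- `R(κ) f` for a sequence `f`; it is only meaningful for `f ∈ ℓ²`. -/
def resolventSeq (C : Coin) (κ : ℂ) (f : Seq) : Seq :=
  if hf : Memℓp f 2 then ⇑(resolventL2 C κ ⟨f, hf⟩) else 0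

/-! ### The anisotropic Agmon–Hörmander spaces and the boundary values of the resolvent -/

/-- `I_j = {y ∈ ℤ : r_{j-1} ≤ |y| < r_j}` with `r_{-1} = 0` and `r_j = 2^j`. -/
def shell : ℕ → Set ℤ
  | 0 => {y | |y| < 1}
  | j + 1 => {y | 2 ^ j ≤ |y| ∧ |y| < 2 ^ (j + 1)}

/-- The quantity `a_j(f)`. -/
def shellNorm (j : ℕ) (f : Seq) : ℝ≥0∞ :=
  (∑' a : Chirality × (ℤ × ℤ),
    {b : Chirality × (ℤ × ℤ) | b.1.along b.2 ∈ shell j}.indicator (fun b => ‖f b‖ₑ ^ 2) a)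
      ^ (1 / 2 : ℝ)

/-- The space `𝓑`: `∑_j r_j^{1/2} a_j(f) < ∞`. -/
def spaceB : Set Seq := {f | ∑' j : ℕ, (2 ^ j : ℝ≥0∞) ^ (1 / 2 : ℝ) * shellNorm j f < ∞}

/-- The space `𝓑^*`: `sup_j r_j^{-1/2} a_j(u) < ∞`. -/
def spaceBDual : Set Seq := {u | ⨆ j : ℕ, (2 ^ j : ℝ≥0∞) ^ (-(1 / 2) : ℝ) * shellNorm j u < ∞}

/-- The pairing `(u, g) = ∑_x ⟨u(x), g(x)⟩` of `𝓑^*` and `𝓑`. -/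
def pairing (u g : Seq) : ℂ := ∑' a, u a * conj (g a)

/-- `κ = θ - i log (1 - s ε)`; the two signs `s = 1` and `s = -1` give `κ_+` and `κ_-`. -/
def kappa (θ s ε : ℝ) : ℂ := (θ : ℂ) - Complex.I * (Real.log (1 - s * ε) : ℂ)

/-- `u ∈ 𝓑^*` is the weak-`*` limit of `R(θ - i log (1 - s ε)) f` as `ε ↓ 0`. -/
def IsResolventLimit (C : Coin) (θ s : ℝ) (f u : Seq) : Prop :=
  u ∈ spaceBDual ∧ ∀ g ∈ spaceB,
    Tendsto (fun ε : ℝ => pairing (resolventSeq C (kappa θ s ε) f) g) (𝓝[>] 0) (𝓝 (pairing u g))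

open Classical in
/-- `R(θ + i0) f` for `s = 1` and `R(θ - i0) f` for `s = -1`. -/
def resolventLim (C : Coin) (θ s : ℝ) (f : Seq) : Seq :=
  if h : ∃ u, IsResolventLimit C θ s f u then h.choose else 0

/-! ### The spectral representations and the operator `A(θ)` -/

/-- The component `(F⁽⁰⁾_p(θ) f)(y)`. -/
def fourier₀ (θ : ℝ) (f : Seq) (p : Chirality) (y : ℤ) : ℂ :=
  ((1 / Real.sqrt (2 * Real.pi) : ℝ) : ℂ) *
    ∑' t : ℤ, Complex.exp (-(Complex.I * (p.sgn * θ * t))) * f (p, p.site t y)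

/-- The component `(F⁽±⁾_p(θ) f)(y)`, where `F⁽±⁾(θ) = F⁽⁰⁾(θ) (1 - V R(θ ± i0))`. -/
def distFourier (C : Coin) (θ s : ℝ) (f : Seq) (p : Chirality) (y : ℤ) : ℂ :=
  fourier₀ θ (f - pert C (resolventLim C θ s f)) p y

/-- The adjoint `T^* φ` of an operator `T` from `𝓑` to `𝐡(θ)`, computed by
`(T^* φ)_p(x) = (T^* φ, δ_x 𝐞_p) = (φ, T (δ_x 𝐞_p))_{𝐡(θ)}`. -/
def adjSeq (T : Seq → Chirality → ℤ → ℂ) (φ : HSpace) : Seq :=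
  fun a => ∑' b : Chirality × ℤ, φ b * conj (T (Pi.single a 1) b.1 b.2)

/-- The free generalized eigenfunction `u⁽⁰⁾ = F⁽⁰⁾(θ)^* φ`. -/
def freeWave (θ : ℝ) (φ : HSpace) : Seq := adjSeq (fourier₀ θ) φ

/-- The generalized eigenfunction `u⁽⁺⁾ = F⁽⁺⁾(θ)^* φ`. -/
def distWave (C : Coin) (θ : ℝ) (φ : HSpace) : Seq := adjSeq (distFourier C θ 1) φ

/-- The scattered wave `v⁽⁺⁾ = u⁽⁺⁾ - u⁽⁰⁾`. -/
def scatteredWave (C : Coin) (θ : ℝ) (φ : HSpace) : Seq := distWave C θ φ - freeWave θ φ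

/-- The component `(A_p(θ) φ)(y)`, where `A_p(θ) = F⁽⁻⁾_p(θ) V^* F⁽⁰⁾(θ)^*`. -/
def scatA (C : Coin) (θ : ℝ) (φ : HSpace) (p : Chirality) (y : ℤ) : ℂ :=
  distFourier C θ (-1) (pertAdj C (freeWave θ φ)) p y

end QWalk

end

namespace QWalk

/-! ### Coordinates along and across the direction of motion -/

/-! The free walk decouples into translations along lines, so its resolvent R₀ is explicit: `freeRes
s z g` sums `g` over one of the two half-rays of the shift, the half being fixed by the side of the
unit circle from which `z` comes. Since V = S(C - 1) sees only the values on D, the resolvent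
equation becomes the Lippmann–Schwinger equation u = R₀(f - Vu): a finite linear system on D,
followed by an explicit extension to the plane.

Limiting absorption thus reduces to invertibility of that system for |z| = 1. A kernel vector yields
u = -R₀Vu. Such a u vanishes on one of the two boundary layers of every large square, and unitarity
then forces it to vanish on the other (`LippmannSchwinger.eq_zero_of_boundary`). So u is zero far
out, and the nonzero minors carry the zero inwards diagonal by diagonal (`eq_zero_of_walk_eq_smul`).
Inverting the system gives pointwise limits (`tendsto_lippmannSchwinger`); a uniform bound and
support in strips make them weak-* limits (`exists_isResolventLimit`).

For the scattering part put z = e^{iθ} and h = V^* F⁽⁰⁾(θ)^* φ, which lives on D. Unitarity gives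
R(θ + i0)^* = -z(1 + zR(θ - i0)) in paired form, hence v⁽⁺⁾ = z h + z² R(θ - i0)h
(`scatteredWave_eq`). Moreover R(θ - i0)h = R₀g with g = h - V R(θ - i0)h, while A(θ)φ = F⁽⁰⁾(θ)g by
definition. As g is finitely supported inside the corridors, so are its strips, and beyond its
support the half-ray sum is a complete Fourier sum: a plane wave with amplitude A(θ)φ
(`freeRes_neg_one_eq`). Finite rank holds because h depends on finitely many functionals of φ. -/

theorem Chirality.along_sub_smul (p : Chirality) (x : ℤ × ℤ) (n : ℤ) :
    p.along (x - n • p.step) = p.along x - n * p.sgn := by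
  cases p <;> simp [Chirality.along, Chirality.step, Chirality.sgn]

theorem Chirality.across_sub_smul (p : Chirality) (x : ℤ × ℤ) (n : ℤ) :
    p.across (x - n • p.step) = p.across x := by
  cases p <;> simp [Chirality.across, Chirality.step]

theorem Chirality.along_add_step (p : Chirality) (x : ℤ × ℤ) :
    p.along (x + p.step) = p.along x + p.sgn := by
  cases p <;> simp [Chirality.along, Chirality.step, Chirality.sgn]

theorem Chirality.across_add_step (p : Chirality) (x : ℤ × ℤ) :
    p.across (x + p.step) = p.across x := by
  cases p <;> simp [Chirality.across, Chirality.step]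

theorem Chirality.sgn_eq (p : Chirality) : p.sgn = 1 ∨ p.sgn = -1 := by
  cases p <;> simp [Chirality.sgn]

theorem Chirality.sgn_mul_sgn (p : Chirality) : p.sgn * p.sgn = 1 := by
  cases p <;> simp [Chirality.sgn]

theorem Chirality.site_eq_sub_smul (p : Chirality) (x : ℤ × ℤ) (n : ℤ) :
    p.site (p.along x - p.sgn * n) (p.across x) = x - n • p.step := by
  cases p <;> ext <;> simp [Chirality.along, Chirality.across, Chirality.site, Chirality.step,
    Chirality.sgn]

theorem Chirality.site_along_across (p : Chirality) (x : ℤ × ℤ) :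
    p.site (p.along x) (p.across x) = x := by
  cases p <;> rfl

theorem Chirality.along_site (p : Chirality) (t y : ℤ) : p.along (p.site t y) = t := by
  cases p <;> rfl

theorem Chirality.across_site (p : Chirality) (t y : ℤ) : p.across (p.site t y) = y := by
  cases p <;> rfl

theorem Chirality.mem_box_iff (p : Chirality) {N : ℕ} {x : ℤ × ℤ} :
    x ∈ box N ↔ |p.along x| ≤ N ∧ |p.across x| ≤ N := by
  cases p <;> simp [Chirality.along, Chirality.across, box, and_comm]

theorem finite_box (N : ℕ) : (box N).Finite := by
  refine (((Set.finite_Icc (-(N : ℤ)) N).prod (Set.finite_Icc (-(N : ℤ)) N))).subset ?_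
  intro x hx
  exact ⟨abs_le.mp hx.1, abs_le.mp hx.2⟩

theorem box_mono {M N : ℕ} (h : M ≤ N) : box M ⊆ box N := fun _ hx =>
  ⟨hx.1.trans (by exact_mod_cast h), hx.2.trans (by exact_mod_cast h)⟩

theorem exists_support_subset_box {g : Seq} (hg : g.support.Finite) :
    ∃ N : ℕ, ∀ a, g a ≠ 0 → a.2 ∈ box N := by
  classical
  refine ⟨hg.toFinset.sup fun a => a.2.1.natAbs + a.2.2.natAbs, fun a ha => ?_⟩
  have h : a.2.1.natAbs + a.2.2.natAbs ≤ _ :=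
    Finset.le_sup (f := fun a : Chirality × (ℤ × ℤ) => a.2.1.natAbs + a.2.2.natAbs)
      (hg.mem_toFinset.mpr ha)
  constructor <;> rw [Int.abs_eq_natAbs] <;> omega

theorem finite_support_of_box {g : Seq} {N : ℕ} (h : ∀ a, g a ≠ 0 → a.2 ∈ box N) :
    g.support.Finite :=
  (Set.finite_univ.prod (finite_box N)).subset fun a ha => ⟨trivial, h a ha⟩

theorem eq_sum_single {g : Seq} {F : Finset (Chirality × (ℤ × ℤ))} (h : ∀ a, g a ≠ 0 → a ∈ F) :
    g = ∑ b ∈ F, g b • (Pi.single b 1 : Seq) := by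
  ext a
  rw [Finset.sum_apply]
  simp only [Pi.smul_apply, Pi.single_apply, smul_eq_mul, mul_ite, mul_one, mul_zero,
    Finset.sum_ite_eq]
  split_ifs with ha
  · rfl
  · by_contra h0
    exact ha (h a h0)

/-! ### The free resolvent -/

/-- The coefficients of the free resolvent along the orbit of the shift: the indicator of `n ≥ 1`
for `s = 1`, and minus the indicator of `n ≤ 0` for `s = -1`. -/
noncomputable def outCoef (s : ℝ) (n : ℤ) : ℂ := (if 1 ≤ n then 1 else 0) + ((s - 1) / 2 : ℝ)

theorem outCoef_one (n : ℤ) : outCoef 1 n = if 1 ≤ n then 1 else 0 := by simp [outCoef]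

theorem outCoef_neg_one (n : ℤ) : outCoef (-1) n = if 1 ≤ n then 0 else -1 := by
  unfold outCoef
  split_ifs <;> norm_num

/-- Both choices of `s` have the same unit jump between 0 and 1, so either half-ray sum inverts S -
z. -/
theorem outCoef_add_one_sub (s : ℝ) (n : ℤ) :
    outCoef s (n + 1) - outCoef s n = if n = 0 then 1 else 0 := by
  unfold outCoef
  rcases lt_trichotomy n 0 with h | h | h
  · rw [if_neg (by omega), if_neg (by omega), if_neg (by omega)]; ring
  · rw [if_pos (by omega), if_neg (by omega), if_pos h]; ring
  · rw [if_pos (by omega), if_pos (by omega), if_neg (by omega)]; ring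

/-- The free resolvent `R₀(κ) = (S - z)⁻¹`, `z = exp (iκ)`, with the choice of side of the unit
circle made by `s`, on finitely supported sequences. -/
noncomputable def freeRes (s : ℝ) (z : ℂ) (g : Seq) : Seq :=
  fun a => ∑' n : ℤ, outCoef s n * z ^ (n - 1) * g (a.1, a.2 - n • a.1.step)

theorem ray_injective (a : Chirality × (ℤ × ℤ)) :
    Function.Injective fun n : ℤ => (a.1, a.2 - n • a.1.step) := by
  intro m n h
  have h' := congrArg (fun b : Chirality × (ℤ × ℤ) => a.1.along b.2) h
  simp only [Chirality.along_sub_smul] at h'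
  rcases a.1.sgn_eq with e | e <;> rw [e] at h' <;> omega

theorem finite_support_ray {g : Seq} (hg : g.support.Finite) (a : Chirality × (ℤ × ℤ)) :
    {n : ℤ | g (a.1, a.2 - n • a.1.step) ≠ 0}.Finite :=
  hg.preimage (ray_injective a).injOn

theorem summable_freeRes (s : ℝ) (z : ℂ) {g : Seq} (hg : g.support.Finite)
    (a : Chirality × (ℤ × ℤ)) :
    Summable fun n : ℤ => outCoef s n * z ^ (n - 1) * g (a.1, a.2 - n • a.1.step) :=
  summable_of_hasFiniteSupport ((finite_support_ray hg a).subset fun _ hn => right_ne_zero_of_mul hn)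

theorem freeRes_add (s : ℝ) (z : ℂ) {f g : Seq} (hf : f.support.Finite) (hg : g.support.Finite) :
    freeRes s z (f + g) = freeRes s z f + freeRes s z g := by
  ext a
  rw [Pi.add_apply]
  unfold freeRes
  rw [← (summable_freeRes s z hf a).tsum_add (summable_freeRes s z hg a)]
  simp only [Pi.add_apply, mul_add]

theorem freeRes_smul (s : ℝ) (z c : ℂ) (g : Seq) :
    freeRes s z (c • g) = c • freeRes s z g := by
  ext a
  rw [Pi.smul_apply, smul_eq_mul]
  unfold freeRes
  rw [← tsum_mul_left]
  exact tsum_congr fun n => by rw [Pi.smul_apply, smul_eq_mul]; ring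

theorem freeRes_zero (s : ℝ) (z : ℂ) : freeRes s z 0 = 0 := by
  ext a; simp [freeRes]

theorem freeRes_neg (s : ℝ) (z : ℂ) (g : Seq) : freeRes s z (-g) = -freeRes s z g := by
  simpa using freeRes_smul s z (-1) g

theorem freeRes_sub (s : ℝ) (z : ℂ) {f g : Seq} (hf : f.support.Finite) (hg : g.support.Finite) :
    freeRes s z (f - g) = freeRes s z f - freeRes s z g := by
  rw [sub_eq_add_neg, freeRes_add s z hf (by rwa [Function.support_neg]), freeRes_neg,
    sub_eq_add_neg]

theorem finite_support_add {f g : Seq} (hf : f.support.Finite) (hg : g.support.Finite) :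
    (f + g).support.Finite := (hf.union hg).subset (Function.support_add f g)

theorem finite_support_sub {f g : Seq} (hf : f.support.Finite) (hg : g.support.Finite) :
    (f - g).support.Finite := (hf.union hg).subset (Function.support_sub f g)

theorem finite_support_smul (c : ℂ) {f : Seq} (hf : f.support.Finite) :
    (c • f).support.Finite := hf.subset (Function.support_const_smul_subset c f)

theorem finite_support_single (a : Chirality × (ℤ × ℤ)) :
    (Pi.single a 1 : Seq).support.Finite :=
  (Set.finite_singleton a).subset Pi.support_single_subset

theorem finite_support_sum {ι : Type} (F : Finset ι) (f : ι → Seq)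
    (hf : ∀ i ∈ F, (f i).support.Finite) : (∑ i ∈ F, f i).support.Finite := by
  classical
  induction F using Finset.induction_on with
  | empty => simp
  | insert i F hi ih =>
    rw [Finset.sum_insert hi]
    exact finite_support_add (hf i (by simp)) (ih fun j hj => hf j (by simp [hj]))

theorem freeRes_sum (s : ℝ) (z : ℂ) {ι : Type} (F : Finset ι) (f : ι → Seq)
    (hf : ∀ i ∈ F, (f i).support.Finite) :
    freeRes s z (∑ i ∈ F, f i) = ∑ i ∈ F, freeRes s z (f i) := by
  classical
  induction F using Finset.induction_on with
  | empty => simp [freeRes_zero]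
  | insert i F hi ih =>
    rw [Finset.sum_insert hi, Finset.sum_insert hi, freeRes_add s z (hf i (by simp))
      (finite_support_sum F f fun j hj => hf j (by simp [hj])), ih fun j hj => hf j (by simp [hj])]

/-- The free resolvent inverts `S - z`. -/
theorem shift_freeRes_sub (s : ℝ) {z : ℂ} (hz : z ≠ 0) {g : Seq} (hg : g.support.Finite) :
    shift (freeRes s z g) - z • freeRes s z g = g := by
  ext ⟨p, x⟩
  have h1 : shift (freeRes s z g) (p, x) =
      ∑' n : ℤ, outCoef s (n + 1) * z ^ n * g (p, x - n • p.step) := by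
    simp only [shift, freeRes]
    rw [← (Equiv.addRight (1 : ℤ)).tsum_eq]
    refine tsum_congr fun n => ?_
    simp only [Equiv.coe_addRight, add_sub_cancel_right, add_smul, one_smul]
    rw [add_sub_add_right_eq_sub]
  have h2 : (z • freeRes s z g) (p, x) =
      ∑' n : ℤ, outCoef s n * z ^ n * g (p, x - n • p.step) := by
    rw [Pi.smul_apply, smul_eq_mul]
    simp only [freeRes]
    rw [← tsum_mul_left]
    refine tsum_congr fun n => ?_
    rw [zpow_sub_one₀ hz]
    field_simp
  have hs : ∀ c : ℤ → ℂ, Summable fun n : ℤ => c n * z ^ n * g (p, x - n • p.step) := fun c =>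
    summable_of_hasFiniteSupport
      ((finite_support_ray hg (p, x)).subset fun _ hn => right_ne_zero_of_mul hn)
  rw [Pi.sub_apply, h1, h2, ← (hs fun n => outCoef s (n + 1)).tsum_sub (hs (outCoef s)),
    tsum_eq_single 0]
  · have := outCoef_add_one_sub s 0
    rw [if_pos rfl] at this
    rw [← sub_mul, ← sub_mul, this]
    simp
  · intro n hn
    have := outCoef_add_one_sub s n
    rw [if_neg hn] at this
    rw [← sub_mul, ← sub_mul, this]
    simp

theorem freeRes_eq_zero (s : ℝ) (z : ℂ) {g : Seq} {a : Chirality × (ℤ × ℤ)}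
    (h : ∀ n : ℤ, outCoef s n ≠ 0 → g (a.1, a.2 - n • a.1.step) = 0) : freeRes s z g a = 0 := by
  unfold freeRes
  rw [← tsum_zero (β := ℤ)]
  refine tsum_congr fun n => ?_
  by_cases hn : outCoef s n = 0
  · simp [hn]
  · rw [h n hn, mul_zero]

theorem exists_of_freeRes_ne_zero {s : ℝ} {z : ℂ} {g : Seq} {a : Chirality × (ℤ × ℤ)}
    (h : freeRes s z g a ≠ 0) :
    ∃ n : ℤ, outCoef s n ≠ 0 ∧ g (a.1, a.2 - n • a.1.step) ≠ 0 := by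
  by_contra! hn
  exact h (freeRes_eq_zero s z hn)

/-- Off the strips that meet the support of `g`, the free resolvent of `g` vanishes. -/
theorem freeRes_across (s : ℝ) (z : ℂ) {g : Seq} {N : ℕ} (hg : ∀ a, g a ≠ 0 → |a.1.across a.2| ≤ N)
    {a : Chirality × (ℤ × ℤ)} (h : freeRes s z g a ≠ 0) : |a.1.across a.2| ≤ N := by
  obtain ⟨n, -, hn⟩ := exists_of_freeRes_ne_zero h
  simpa only [Chirality.across_sub_smul] using hg _ hn

theorem continuousAt_freeRes (s : ℝ) {z₀ : ℂ} (hz : z₀ ≠ 0) {g : Seq} (hg : g.support.Finite)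
    (a : Chirality × (ℤ × ℤ)) : ContinuousAt (fun z => freeRes s z g a) z₀ := by
  have h : (fun z => freeRes s z g a) = fun z => ∑ n ∈ (finite_support_ray hg a).toFinset,
      outCoef s n * z ^ (n - 1) * g (a.1, a.2 - n • a.1.step) := by
    ext z
    refine tsum_eq_sum fun n hn => ?_
    have : g (a.1, a.2 - n • a.1.step) = 0 := by simpa using hn
    rw [this, mul_zero]
  rw [h]
  refine tendsto_finsetSum _ fun n _ => ?_
  exact (((continuousAt_zpow₀ z₀ (n - 1) (Or.inl hz)).tendsto.const_mul _).mul_const _)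

/-- On the side of the unit circle chosen by `s`, the free resolvent of a finitely supported
sequence is bounded uniformly up to the circle. -/
theorem norm_freeRes_le {s : ℝ} {z : ℂ} (hs : (s = 1 ∧ ‖z‖ ≤ 1) ∨ (s = -1 ∧ 1 ≤ ‖z‖)) {g : Seq}
    (hg : g.support.Finite) (a : Chirality × (ℤ × ℤ)) : ‖freeRes s z g a‖ ≤ ∑' b, ‖g b‖ := by
  -- The surviving exponents `n - 1` are nonnegative for `s = 1` and negative for `s = -1`, matching
  -- the side of the circle.
  have hc : ∀ n : ℤ, ‖outCoef s n * z ^ (n - 1)‖ ≤ 1 := by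
    intro n
    rw [norm_mul, norm_zpow]
    rcases hs with ⟨rfl, hz⟩ | ⟨rfl, hz⟩
    · rw [outCoef_one]
      split_ifs with hn
      · obtain ⟨k, hk⟩ := Int.eq_ofNat_of_zero_le (sub_nonneg.mpr hn)
        rw [hk, zpow_natCast, norm_one, one_mul]
        exact pow_le_one₀ (norm_nonneg _) hz
      · simp
    · rw [outCoef_neg_one]
      split_ifs with hn
      · simp
      · rw [norm_neg, norm_one, one_mul]
        exact zpow_le_one_of_nonpos₀ hz (by omega)
  have hsum : Summable fun b => ‖g b‖ :=
    summable_of_hasFiniteSupport (hg.subset fun b hb => by simpa using hb)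
  have hray : Summable fun n : ℤ => ‖g (a.1, a.2 - n • a.1.step)‖ :=
    hsum.comp_injective (ray_injective a)
  have hle : ∀ n : ℤ, ‖outCoef s n * z ^ (n - 1) * g (a.1, a.2 - n • a.1.step)‖ ≤
      ‖g (a.1, a.2 - n • a.1.step)‖ := fun n => by
    rw [norm_mul]
    exact mul_le_of_le_one_left (norm_nonneg _) (hc n)
  calc ‖freeRes s z g a‖ ≤ ∑' n : ℤ, ‖g (a.1, a.2 - n • a.1.step)‖ :=
        tsum_of_norm_bounded hray.hasSum hle
    _ ≤ ∑' b, ‖g b‖ :=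
        Summable.tsum_le_tsum_of_inj _ (ray_injective a) (fun _ _ => norm_nonneg _)
          (fun _ => le_rfl) hray hsum

/-! ### The perturbation -/

theorem pert_apply (C : Coin) (u : Seq) (a : Chirality × (ℤ × ℤ)) :
    pert C u a = coinMul C u (a.1, a.2 + a.1.step) - u (a.1, a.2 + a.1.step) := rfl

theorem pertAdj_apply (C : Coin) (u : Seq) (a : Chirality × (ℤ × ℤ)) :
    pertAdj C u a = coinAdjMul C (shiftInv u) a - shiftInv u a := rfl

theorem walk_eq (C : Coin) (u : Seq) : walk C u = shift u + pert C u := by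
  simp [pert]

theorem coinMul_eq_self {C : Coin} {u : Seq} {a : Chirality × (ℤ × ℤ)} (h : C a.2 = 1) :
    coinMul C u a = u a := by
  simp [coinMul, h, Matrix.one_apply]

theorem coinAdjMul_eq_self {C : Coin} {u : Seq} {a : Chirality × (ℤ × ℤ)} (h : C a.2 = 1) :
    coinAdjMul C u a = u a := by
  simp [coinAdjMul, h, Matrix.one_apply, apply_ite]

theorem pert_add (C : Coin) (u v : Seq) : pert C (u + v) = pert C u + pert C v := by
  ext a
  simp only [pert_apply, coinMul, Pi.add_apply, mul_add, Finset.sum_add_distrib]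
  ring

theorem pert_smul (C : Coin) (c : ℂ) (u : Seq) : pert C (c • u) = c • pert C u := by
  ext a
  simp only [pert_apply, coinMul, Pi.smul_apply, smul_eq_mul, mul_sub, Finset.mul_sum,
    mul_left_comm]

theorem pert_zero (C : Coin) : pert C 0 = 0 := by
  simpa using pert_smul C 0 0

theorem pert_sub (C : Coin) (u v : Seq) : pert C (u - v) = pert C u - pert C v := by
  rw [sub_eq_add_neg, pert_add, ← neg_one_smul ℂ v, pert_smul, neg_one_smul, sub_eq_add_neg]

theorem pert_sum (C : Coin) {ι : Type} (F : Finset ι) (f : ι → Seq) :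
    pert C (∑ i ∈ F, f i) = ∑ i ∈ F, pert C (f i) := by
  classical
  induction F using Finset.induction_on with
  | empty => simp [pert_zero]
  | insert i F hi ih => rw [Finset.sum_insert hi, Finset.sum_insert hi, pert_add, ih]

/-- Because V = S(C - 1), the support is D moved back by one step. This one-site displacement along
the motion is the source of the margins `n₀ + 1` below. -/
theorem pert_ne_zero {C : Coin} {n₀ : ℕ} (hC : C.Admissible n₀) {u : Seq}
    {a : Chirality × (ℤ × ℤ)} (h : pert C u a ≠ 0) : a.2 + a.1.step ∈ box n₀ := by
  by_contra hb
  rw [pert_apply, coinMul_eq_self (hC.eq_one _ hb), sub_self] at h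
  exact h rfl

theorem pert_across {C : Coin} {n₀ : ℕ} (hC : C.Admissible n₀) {u : Seq}
    {a : Chirality × (ℤ × ℤ)} (h : pert C u a ≠ 0) : |a.1.across a.2| ≤ n₀ := by
  have := (a.1.mem_box_iff.mp (pert_ne_zero hC h)).2
  rwa [Chirality.across_add_step] at this

theorem pert_mem_box {C : Coin} {n₀ : ℕ} (hC : C.Admissible n₀) {u : Seq}
    {a : Chirality × (ℤ × ℤ)} (h : pert C u a ≠ 0) : a.2 ∈ box (n₀ + 1) := by
  obtain ⟨h1, h2⟩ := a.1.mem_box_iff.mp (pert_ne_zero hC h)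
  rw [Chirality.along_add_step, abs_le] at h1
  rw [Chirality.across_add_step, abs_le] at h2
  rw [a.1.mem_box_iff, abs_le, abs_le]
  push_cast
  rcases a.1.sgn_eq with e | e <;> rw [e] at h1 <;> omega

theorem finite_support_pert {C : Coin} {n₀ : ℕ} (hC : C.Admissible n₀) (u : Seq) :
    (pert C u).support.Finite :=
  finite_support_of_box fun _ ha => pert_mem_box hC ha

/-- The finite set of pairs of a chirality and a site of the square of half width `N`. -/
noncomputable def boxFinset (N : ℕ) : Finset (Chirality × (ℤ × ℤ)) :=
  Finset.univ ×ˢ (finite_box N).toFinset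

theorem mem_boxFinset {N : ℕ} {a : Chirality × (ℤ × ℤ)} : a ∈ boxFinset N ↔ a.2 ∈ box N := by
  simp [boxFinset]

/-- `V u` only depends on the values of `u` on the square `D`. -/
theorem pert_eq_sum {C : Coin} {n₀ : ℕ} (hC : C.Admissible n₀) (u : Seq) :
    pert C u = ∑ b ∈ boxFinset n₀, u b • pert C (Pi.single b 1) := by
  simp_rw [← pert_smul]
  rw [← pert_sum, ← sub_eq_zero, ← pert_sub]
  have h0 : ∀ a : Chirality × (ℤ × ℤ), a.2 ∈ box n₀ →
      (u - ∑ b ∈ boxFinset n₀, u b • (Pi.single b 1 : Seq)) a = 0 := by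
    intro a ha
    rw [Pi.sub_apply, Finset.sum_apply]
    simp [Pi.single_apply, mem_boxFinset.mpr ha]
  ext a
  by_contra h
  have hb := pert_ne_zero hC h
  refine h ?_
  rw [pert_apply, h0 _ hb, coinMul, Finset.sum_eq_zero fun q _ => by rw [h0 (q, _) hb, mul_zero]]
  simp

/-- The Lippmann–Schwinger equation `u = R₀ (f - V u)`. -/
def LippmannSchwinger (C : Coin) (s : ℝ) (z : ℂ) (f u : Seq) : Prop :=
  u = freeRes s z (f - pert C u)

theorem LippmannSchwinger.walk_eq {C : Coin} {n₀ : ℕ} (hC : C.Admissible n₀) {s : ℝ} {z : ℂ}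
    (hz : z ≠ 0) {f u : Seq} (hf : f.support.Finite) (h : LippmannSchwinger C s z f u) :
    walk C u = z • u + f := by
  have := shift_freeRes_sub s hz (finite_support_sub hf (finite_support_pert hC u))
  rw [← h] at this
  rw [QWalk.walk_eq, sub_eq_iff_eq_add.mp this]
  abel

theorem LippmannSchwinger.add {C : Coin} {n₀ : ℕ} (hC : C.Admissible n₀) {s : ℝ} {z : ℂ}
    {f g u v : Seq} (hf : f.support.Finite) (hg : g.support.Finite)
    (hu : LippmannSchwinger C s z f u) (hv : LippmannSchwinger C s z g v) :
    LippmannSchwinger C s z (f + g) (u + v) := by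
  unfold LippmannSchwinger at *
  rw [pert_add, add_sub_add_comm, freeRes_add s z (finite_support_sub hf (finite_support_pert hC u))
    (finite_support_sub hg (finite_support_pert hC v)), ← hu, ← hv]

theorem LippmannSchwinger.smul {C : Coin} {s : ℝ} {z : ℂ} {f u : Seq} (c : ℂ)
    (hu : LippmannSchwinger C s z f u) : LippmannSchwinger C s z (c • f) (c • u) := by
  unfold LippmannSchwinger at *
  rw [pert_smul, ← smul_sub, freeRes_smul, ← hu]

/-- Restricted to D this is a finite linear system for the values of `u` there; read elsewhere, it
recovers `u` from those values. -/
theorem LippmannSchwinger.eq_sub {C : Coin} {n₀ : ℕ} (hC : C.Admissible n₀) {s : ℝ} {z : ℂ}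
    {f u : Seq} (hf : f.support.Finite) (hu : LippmannSchwinger C s z f u) :
    u = freeRes s z f -
      ∑ b ∈ boxFinset n₀, u b • freeRes s z (pert C (Pi.single b 1)) := by
  have h := hu
  unfold LippmannSchwinger at h
  rw [freeRes_sub s z hf (finite_support_pert hC u), pert_eq_sum hC u, freeRes_sum s z _ _
    fun b _ => finite_support_smul _ (finite_support_pert hC _)] at h
  simpa only [freeRes_smul] using h

/-! ### Unitarity -/

theorem sum_coin_mul_conj (M : Matrix.unitaryGroup Chirality ℂ) (v w : Chirality → ℂ) :
    ∑ p, (∑ q, (M : Matrix Chirality Chirality ℂ) p q * v q) *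
      conj (∑ q, (M : Matrix Chirality Chirality ℂ) p q * w q) = ∑ p, v p * conj (w p) := by
  have h : ((M : Matrix Chirality Chirality ℂ).mulVec v) ⬝ᵥ
      star ((M : Matrix Chirality Chirality ℂ).mulVec w) = v ⬝ᵥ star w := by
    have hM : (M : Matrix Chirality Chirality ℂ).conjTranspose * M = 1 :=
      Matrix.mem_unitaryGroup_iff'.mp M.2
    rw [dotProduct_comm, Matrix.star_mulVec, Matrix.dotProduct_mulVec, Matrix.vecMul_vecMul, hM,
      Matrix.vecMul_one, dotProduct_comm]
  exact h

theorem finite_support_coinMul_mul {C : Coin} {n₀ : ℕ} (hC : C.Admissible n₀) {v w : Seq}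
    (h : (fun a => v a * conj (w a)).support.Finite) :
    (fun a => coinMul C v a * conj (coinMul C w a)).support.Finite := by
  refine (h.union (boxFinset n₀).finite_toSet).subset fun a ha => ?_
  by_cases hb : a.2 ∈ box n₀
  · exact Or.inr (mem_boxFinset.mpr hb)
  · refine Or.inl ?_
    have e := hC.eq_one _ hb
    simpa only [Function.mem_support, coinMul_eq_self e] using ha

theorem tsum_prod_swap {f : Seq} (hf : f.support.Finite) :
    ∑' a, f a = ∑' x : ℤ × ℤ, ∑ p, f (p, x) := by
  have h : Summable f := summable_of_hasFiniteSupport hf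
  have hs := (Equiv.prodComm (ℤ × ℤ) Chirality).summable_iff.mpr h
  rw [← (Equiv.prodComm (ℤ × ℤ) Chirality).tsum_eq]
  refine (hs.tsum_prod' fun _ => Summable.of_finite).trans ?_
  exact tsum_congr fun x => tsum_fintype _

/-- Unitarity for sequences that need not be in ℓ², as boundary values of the resolvent need not be:
only the pointwise product must have finite support, and the coin changes that product only on D. -/
theorem tsum_walk_mul_conj {C : Coin} {n₀ : ℕ} (hC : C.Admissible n₀) {v w : Seq}
    (h : (fun a => v a * conj (w a)).support.Finite) :
    ∑' a, walk C v a * conj (walk C w a) = ∑' a, v a * conj (w a) := by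
  refine (shiftEquiv.tsum_eq fun a => coinMul C v a * conj (coinMul C w a)).trans ?_
  rw [tsum_prod_swap (finite_support_coinMul_mul hC h), tsum_prod_swap h]
  exact tsum_congr fun x => sum_coin_mul_conj (C x) (fun q => v (q, x)) (fun q => w (q, x))

/-! ### Absence of outgoing solutions of the homogeneous equation -/

theorem Coin.Admissible.det_ne_zero {C : Coin} {n₀ : ℕ} (hC : C.Admissible n₀) (x : ℤ × ℤ) :
    ((C x : Matrix Chirality Chirality ℂ).submatrix
      ![Chirality.right, Chirality.up] ![Chirality.right, Chirality.up]).det ≠ 0 := by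
  by_cases hx : x ∈ box n₀
  · exact hC.det_even x hx
  · rw [hC.eq_one x hx, Matrix.det_fin_two]
    simp [Matrix.one_apply]

/-- Unique continuation: an eigenfunction of the walk that vanishes on a half plane
`x₁ + x₂ ≥ m` vanishes. -/
theorem eq_zero_of_walk_eq_smul {C : Coin} {n₀ : ℕ} (hC : C.Admissible n₀) {z : ℂ} (hz : z ≠ 0)
    {u : Seq} (hu : walk C u = z • u) (m : ℤ) (hm : ∀ a, m ≤ a.2.1 + a.2.2 → u a = 0) : u = 0 := by
  have hw : ∀ p x, coinMul C u (p, x + p.step) = z * u (p, x) := fun p x => congrFun hu (p, x)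
  have key : ∀ k : ℕ, ∀ a : Chirality × (ℤ × ℤ), m - k ≤ a.2.1 + a.2.2 → u a = 0 := by
    intro k
    induction k with
    | zero => simpa using hm
    | succ k ih =>
      rintro ⟨p, x⟩ hx
      have hx' : m - k ≤ x.1 + x.2 + 1 := by push_cast at hx; omega
      have hcoin : ∀ y : ℤ × ℤ, m - k ≤ y.1 + y.2 → ∀ q, coinMul C u (q, y) = 0 := fun y hy q => by
        rw [coinMul, Finset.sum_eq_zero fun r _ => by rw [ih (r, y) hy, mul_zero]]
      -- The components ← and ↓ at `x` are determined by the coin output one diagonal ahead, where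
      -- everything is already zero.
      have hl : u (.left, x) = 0 := by
        have := hw .left x
        rw [hcoin _ (by simp [Chirality.step]; omega)] at this
        exact (mul_eq_zero.mp this.symm).resolve_left hz
      have hd : u (.down, x) = 0 := by
        have := hw .down x
        rw [hcoin _ (by simp [Chirality.step]; omega)] at this
        exact (mul_eq_zero.mp this.symm).resolve_left hz
      -- For → and ↑ the equation is read backwards: the coin output at `x` is a multiple of `u` one
      -- diagonal ahead.
      have hr : coinMul C u (.right, x) = 0 := by
        have := hw .right (x - Chirality.right.step)
        rw [sub_add_cancel] at this
        rw [this, ih _ (by simp [Chirality.step]; omega), mul_zero]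
      have hup : coinMul C u (.up, x) = 0 := by
        have := hw .up (x - Chirality.up.step)
        rw [sub_add_cancel] at this
        rw [this, ih _ (by simp [Chirality.step]; omega), mul_zero]
      have huniv : (Finset.univ : Finset Chirality) =
        {Chirality.left, Chirality.right, Chirality.down, Chirality.up} := rfl
      -- With ← and ↓ gone, the two vanishing outputs form a homogeneous system whose matrix is the
      -- minor on →, ↑.
      have hv := Matrix.eq_zero_of_mulVec_eq_zero (hC.det_ne_zero x)
        (v := ![u (.right, x), u (.up, x)]) (by
          simp only [coinMul, huniv] at hr hup
          simp [hl, hd] at hr hup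
          ext i
          fin_cases i <;> simp [Matrix.mulVec, dotProduct, Fin.sum_univ_two, hr, hup])
      have h0 : u (.right, x) = 0 := congrFun hv 0
      have h1 : u (.up, x) = 0 := congrFun hv 1
      cases p <;> assumption
  ext a
  exact key (m - (a.2.1 + a.2.2)).toNat a (by omega)

theorem outCoef_ne_zero {s : ℝ} (hs : s = 1 ∨ s = -1) {n : ℤ} :
    outCoef s n ≠ 0 ↔ (s = 1 ∧ 1 ≤ n) ∨ (s = -1 ∧ n ≤ 0) := by
  rcases hs with rfl | rfl
  · rw [outCoef_one]; norm_num
  · rw [outCoef_neg_one]; norm_num [Int.lt_iff_add_one_le]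

/-- Conservation of the flux through the boundary of a large square: an outgoing solution of the
homogeneous equation vanishes where the shift enters or leaves the square. -/
theorem LippmannSchwinger.eq_zero_of_boundary {C : Coin} {n₀ : ℕ} (hC : C.Admissible n₀) {s : ℝ}
    (hs : s = 1 ∨ s = -1) {z : ℂ} (hz : ‖z‖ = 1) {u : Seq} (hu : LippmannSchwinger C s z 0 u)
    {N : ℕ} (hN : n₀ + 2 ≤ N) (a : Chirality × (ℤ × ℤ))
    (ha : ¬(a.2 ∈ box N ↔ a.2 + a.1.step ∈ box N)) : u a = 0 := by
  classical
  have hz0 : z ≠ 0 := fun h => by simp [h] at hz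
  have hw := hu.walk_eq hC hz0 (by simp)
  rw [add_zero] at hw
  have hN' : (n₀ : ℤ) + 2 ≤ N := by exact_mod_cast hN
  -- the boundary layer on the incoming side
  have hin : ∀ b : Chirality × (ℤ × ℤ),
      (s = 1 → b.2 ∉ box N ∧ b.2 + b.1.step ∈ box N) →
      (s = -1 → b.2 ∈ box N ∧ b.2 + b.1.step ∉ box N) → u b = 0 := by
    rintro ⟨p, x⟩ h1 h2
    rw [hu]
    -- The half-ray from this layer runs away from `box (n₀ + 1)`, which contains the source. For `s
    -- = -1` the ray includes its own starting site `n = 0`, hence the requirement `n₀ + 2 ≤ N`.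
    refine freeRes_eq_zero s z fun n hn => ?_
    by_contra hne
    have hne' : pert C u (p, x - n • p.step) ≠ 0 := by simpa using hne
    have hm := p.mem_box_iff.mp (pert_mem_box hC hne')
    rw [Chirality.along_sub_smul, Chirality.across_sub_smul] at hm
    simp only [p.mem_box_iff, Chirality.along_add_step, Chirality.across_add_step, abs_le] at h1 h2 hm
    push_cast at hm
    rcases (outCoef_ne_zero hs).mp hn with ⟨e, hn⟩ | ⟨e, hn⟩
    · have := h1 e
      rcases p.sgn_eq with e | e <;> rw [e] at this hm <;> omega
    · have := h2 e
      rcases p.sgn_eq with e | e <;> rw [e] at this hm <;> omega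
  let v : Seq := fun b => if b.2 ∈ box N then u b else 0
  have hv : v.support.Finite := finite_support_of_box (N := N) fun b hb => by
    by_contra h
    simp [v, h] at hb
  -- The coin acts site by site, so it commutes with the cutoff; only the shift moves the boundary.
  have hwv : ∀ b, walk C v b = if b.2 + b.1.step ∈ box N then z * u b else 0 := by
    rintro ⟨p, x⟩
    have := congrFun hw (p, x)
    simp only [walk, shift, coinMul, v, Pi.smul_apply, smul_eq_mul] at this ⊢
    split_ifs
    · exact this
    · simp
  have hsup : (fun b => v b * conj (v b)).support.Finite :=
    hv.subset fun b hb => left_ne_zero_of_mul hb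
  have hiso := tsum_walk_mul_conj hC hsup
  have hfin : ∀ f : Chirality × (ℤ × ℤ) → ℝ, (∀ b, f b ≠ 0 → b.2 ∈ box (N + 1)) → Summable f :=
    fun f hf => summable_of_hasFiniteSupport
      ((boxFinset (N + 1)).finite_toSet.subset fun b hb => mem_boxFinset.mpr (hf b hb))
  let α : Chirality × (ℤ × ℤ) → ℝ := fun b => if b.2 + b.1.step ∈ box N then ‖u b‖ ^ 2 else 0
  let β : Chirality × (ℤ × ℤ) → ℝ := fun b => if b.2 ∈ box N then ‖u b‖ ^ 2 else 0
  have hα : Summable α := by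
    refine hfin α fun b hb => ?_
    have hb' : b.2 + b.1.step ∈ box N := by
      by_contra h
      simp [α, h] at hb
    rw [b.1.mem_box_iff, Chirality.along_add_step, Chirality.across_add_step, abs_le, abs_le] at hb'
    rw [b.1.mem_box_iff, abs_le, abs_le]
    push_cast
    rcases b.1.sgn_eq with e | e <;> rw [e] at hb' <;> omega
  have hβ : Summable β := hfin β fun b hb => by
    refine box_mono (Nat.le_succ N) ?_
    by_contra h
    simp [β, h] at hb
  -- Equality of the norms of `walk C v` and `v`. The two sums differ only on the entering and
  -- leaving layers; one layer contributes zero by `hin`, so a nonzero value on the other would make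
  -- the inequality strict.
  have hsum : ∑' b, α b = ∑' b, β b := by
    have e1 : ∀ b, walk C v b * conj (walk C v b) = ((α b : ℝ) : ℂ) := fun b => by
      rw [hwv]
      simp only [α]
      split_ifs
      · rw [Complex.mul_conj', norm_mul, hz, one_mul]; norm_cast
      · simp
    have e2 : ∀ b, v b * conj (v b) = ((β b : ℝ) : ℂ) := fun b => by
      simp only [β, v]
      split_ifs
      · rw [Complex.mul_conj']; norm_cast
      · simp
    simp only [e1, e2, ← Complex.ofReal_tsum] at hiso
    exact_mod_cast hiso
  by_contra hne
  have hpos : 0 < ‖u a‖ ^ 2 := by positivity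
  rcases hs with rfl | rfl
  · have hle : ∀ b, α b ≤ β b := fun b => by
      simp only [α, β]
      split_ifs with h1 h2 h2
      · exact le_rfl
      · rw [hin b (fun _ => ⟨h2, h1⟩) (fun h => by norm_num at h)]; simp
      · positivity
      · exact le_rfl
    refine absurd hsum (Summable.tsum_lt_tsum hle (i := a) ?_ hα hβ).ne
    simp only [α, β]
    split_ifs with h1 h2 h2
    · tauto
    · exact absurd (hin a (fun _ => ⟨h2, h1⟩) (fun h => by norm_num at h)) hne
    · exact hpos
    · tauto
  · have hle : ∀ b, β b ≤ α b := fun b => by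
      simp only [α, β]
      split_ifs with h1 h2 h2
      · exact le_rfl
      · rw [hin b (fun h => by norm_num at h) (fun _ => ⟨h1, h2⟩)]; simp
      · positivity
      · exact le_rfl
    refine absurd hsum.symm (Summable.tsum_lt_tsum hle (i := a) ?_ hβ hα).ne
    simp only [α, β]
    split_ifs with h1 h2 h2
    · tauto
    · exact absurd (hin a (fun h => by norm_num at h) (fun _ => ⟨h1, h2⟩)) hne
    · exact hpos
    · tauto

/-- Support in strips and zero flux through all large squares make `u` vanish on a far half plane,
where unique continuation starts. No decay of `u` is assumed. -/
theorem LippmannSchwinger.eq_zero {C : Coin} {n₀ : ℕ} (hC : C.Admissible n₀) {s : ℝ}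
    (hs : s = 1 ∨ s = -1) {z : ℂ} (hz : ‖z‖ = 1) {u : Seq} (hu : LippmannSchwinger C s z 0 u) :
    u = 0 := by
  have hz0 : z ≠ 0 := fun h => by simp [h] at hz
  have hw := hu.walk_eq hC hz0 (by simp)
  rw [add_zero] at hw
  -- On the support the transverse coordinate is at most `n₀`, so this generous threshold puts the
  -- longitudinal one beyond `n₀ + 3`.
  refine eq_zero_of_walk_eq_smul hC hz0 hw (2 * n₀ + 10) fun a ha => ?_
  by_contra hne
  have hac : |a.1.across a.2| ≤ n₀ := by
    refine freeRes_across s z (g := 0 - pert C u) (fun b hb => ?_) (by rwa [← hu])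
    exact pert_across (u := u) hC (by simpa using hb)
  obtain ⟨p, x⟩ := a
  have hal : (n₀ : ℤ) + 3 ≤ p.along x := by
    have hsum : p.along x + p.across x = x.1 + x.2 := by
      cases p <;> simp [Chirality.along, Chirality.across, add_comm]
    rw [abs_le] at hac
    simp only at ha hac
    omega
  obtain ⟨N, hN⟩ := Int.eq_ofNat_of_zero_le (show 0 ≤ p.along x by omega)
  rw [abs_le] at hac
  simp only at hac
  -- The square is chosen so that `x` lies in a boundary layer: the last site inside for sign 1, the
  -- first site outside for sign -1.
  rcases p.sgn_eq with e | e
  · refine hne (hu.eq_zero_of_boundary hC hs hz (N := N) (by omega) (p, x) ?_)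
    simp only [p.mem_box_iff, Chirality.along_add_step, Chirality.across_add_step, abs_le, e]
    omega
  · refine hne (hu.eq_zero_of_boundary hC hs hz (N := N - 1) (by omega) (p, x) ?_)
    simp only [p.mem_box_iff, Chirality.along_add_step, Chirality.across_add_step, abs_le, e]
    omega

theorem LippmannSchwinger.unique {C : Coin} {n₀ : ℕ} (hC : C.Admissible n₀) {s : ℝ}
    (hs : s = 1 ∨ s = -1) {z : ℂ} (hz : ‖z‖ = 1) {f u v : Seq} (hf : f.support.Finite)
    (hu : LippmannSchwinger C s z f u) (hv : LippmannSchwinger C s z f v) : u = v := by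
  have h := hu.add hC hf (finite_support_smul (-1) hf) (hv.smul (-1))
  rw [neg_one_smul, neg_one_smul, add_neg_cancel] at h
  simpa [add_neg_eq_zero] using h.eq_zero hC hs hz

/-! ### The resolvent off the unit circle -/

theorem norm_walkL2_apply (C : Coin) (f : L2) : ‖walkL2 C f‖ = ‖f‖ := by
  have hn : ∀ g : L2, ‖g‖ ^ 2 = ∑' a, ‖g a‖ ^ 2 := fun g => by
    simpa using lp.norm_rpow_eq_tsum (p := 2) (by norm_num) g
  rw [← sq_eq_sq₀ (norm_nonneg _) (norm_nonneg _), hn, hn]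
  exact tsum_walk C ((memL2_iff _).mp (lp.memℓp f))

theorem coinMul_coinMul_star (C : Coin) (f : Seq) : coinMul C (coinMul (star C) f) = f := by
  ext ⟨p, x⟩
  have h : (C x : Matrix Chirality Chirality ℂ).mulVec
      ((star (C x : Matrix Chirality Chirality ℂ)).mulVec fun q => f (q, x)) p = f (p, x) := by
    rw [Matrix.mulVec_mulVec, Matrix.mem_unitaryGroup_iff.mp (C x).2, Matrix.one_mulVec]
  exact h

theorem surjective_walkL2 (C : Coin) : Function.Surjective (walkL2 C) := by
  intro g
  have hg := (memL2_iff _).mp (lp.memℓp g)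
  refine ⟨⟨coinMul (star C) (shiftInv g), (memL2_iff _).mpr (summable_coinMul _ ?_)⟩, ?_⟩
  · exact shiftEquiv.symm.summable_iff.mpr hg
  · ext a
    change shift (coinMul C (coinMul (star C) (shiftInv g))) a = g a
    rw [coinMul_coinMul_star]
    simp [shift, shiftInv]

/-- A surjective isometry is unitary, so its spectrum lies on the unit circle. Hence the
`Ring.inverse` in `resolventL2` is a true inverse off the circle, not the default value 0. -/
theorem isUnit_sub_smul_one_of_isometry {H : Type*} [NormedAddCommGroup H] [InnerProductSpace ℂ H]
    [CompleteSpace H] (T : H →L[ℂ] H) (hT : ∀ x, ‖T x‖ = ‖x‖) (hs : Function.Surjective T) {z : ℂ}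
    (hz : ‖z‖ ≠ 1) : IsUnit (T - z • (1 : H →L[ℂ] H)) := by
  have hu : T ∈ unitary (H →L[ℂ] H) :=
    (Unitary.linearIsometryEquiv.symm
      (LinearIsometryEquiv.ofSurjective ⟨T.toLinearMap, hT⟩ hs : H ≃ₗᵢ[ℂ] H)).2
  have hz' : z ∉ spectrum ℂ T := fun hmem => hz (by
    simpa using spectrum.subset_circle_of_unitary hu hmem)
  have := spectrum.notMem_iff.mp hz'
  rw [Algebra.algebraMap_eq_smul_one] at this
  rw [← neg_sub]
  exact this.neg

theorem isUnit_walkL2_sub (C : Coin) {z : ℂ} (hz : ‖z‖ ≠ 1) :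
    IsUnit (walkL2 C - z • (1 : L2 →L[ℂ] L2)) :=
  isUnit_sub_smul_one_of_isometry _ (norm_walkL2_apply C) (surjective_walkL2 C) hz

theorem memL2_of_finite_support {f : Seq} (hf : f.support.Finite) : Memℓp f 2 :=
  (memL2_iff f).mpr (summable_of_hasFiniteSupport (hf.subset fun a ha => by
    by_contra h
    exact ha (by simp [Function.notMem_support.mp h])))

theorem walk_resolventSeq (C : Coin) {κ : ℂ} (hκ : ‖Complex.exp (Complex.I * κ)‖ ≠ 1) {f : Seq}
    (hf : f.support.Finite) :
    walk C (resolventSeq C κ f) = Complex.exp (Complex.I * κ) • resolventSeq C κ f + f := by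
  have hf' := memL2_of_finite_support hf
  have h := Ring.mul_inverse_cancel _ (isUnit_walkL2_sub C hκ)
  have h' := congrArg (fun T : L2 →L[ℂ] L2 => ⇑(T ⟨f, hf'⟩)) h
  rw [resolventSeq, dif_pos hf']
  ext a
  have h'' := congrFun h' a
  change walk C (resolventL2 C κ ⟨f, hf'⟩) a - Complex.exp (Complex.I * κ) *
    resolventL2 C κ ⟨f, hf'⟩ a = f a at h''
  rw [Pi.add_apply, Pi.smul_apply, smul_eq_mul, ← h'']
  ring

theorem exists_norm_resolventSeq_le (C : Coin) (κ : ℂ) {f : Seq} (hf : f.support.Finite) :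
    ∃ B, ∀ a, ‖resolventSeq C κ f a‖ ≤ B := by
  rw [resolventSeq, dif_pos (memL2_of_finite_support hf)]
  exact ⟨_, lp.norm_apply_le_norm (by norm_num) _⟩

/-- Along an orbit of the shift, `d` is geometric with ratio `z`, hence unbounded in one direction
unless it is zero. -/
theorem eq_zero_of_shift_eq_smul {z : ℂ} (hz : z ≠ 0) (hz1 : ‖z‖ ≠ 1) {d : Seq}
    (hd : shift d = z • d) {B : ℝ} (hB : ∀ a, ‖d a‖ ≤ B) : d = 0 := by
  have hstep : ∀ p x, d (p, x + p.step) = z * d (p, x) := fun p x => congrFun hd (p, x)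
  have hfwd : ∀ (n : ℕ) p x, d (p, x + n • p.step) = z ^ n * d (p, x) := by
    intro n p
    induction n with
    | zero => simp
    | succ n ih =>
      intro x
      rw [succ_nsmul, ← add_assoc, hstep, ih, pow_succ']
      ring
  ext ⟨p, x⟩
  rcases lt_or_gt_of_ne hz1 with h | h
  · have hle : ∀ n : ℕ, ‖d (p, x)‖ ≤ ‖z‖ ^ n * B := fun n => by
      have := hfwd n p (x - n • p.step)
      rw [sub_add_cancel] at this
      rw [this, norm_mul, norm_pow]
      exact mul_le_mul_of_nonneg_left (hB _) (by positivity)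
    have hlim : Tendsto (fun n : ℕ => ‖z‖ ^ n * B) atTop (𝓝 (0 * B)) :=
      (tendsto_pow_atTop_nhds_zero_of_lt_one (norm_nonneg _) h).mul_const B
    rw [zero_mul] at hlim
    exact norm_le_zero_iff.mp (ge_of_tendsto' hlim hle)
  · by_contra hne
    have hpos : 0 < ‖d (p, x)‖ := norm_pos_iff.mpr hne
    obtain ⟨n, hn⟩ := pow_unbounded_of_one_lt (B / ‖d (p, x)‖) h
    have := hB (p, x + n • p.step)
    rw [hfwd, norm_mul, norm_pow, ← le_div_iff₀ hpos] at this
    exact absurd this (not_le.mpr hn)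

/-- Off the unit circle, a bounded solution of `(U - z) u = f` solves the Lippmann–Schwinger
equation. -/
theorem lippmannSchwinger_of_bounded {C : Coin} {n₀ : ℕ} (hC : C.Admissible n₀) {s : ℝ} {z : ℂ}
    (hz : z ≠ 0) (hs : (s = 1 ∧ ‖z‖ < 1) ∨ (s = -1 ∧ 1 < ‖z‖)) {f u : Seq} (hf : f.support.Finite)
    (hu : walk C u = z • u + f) {B : ℝ} (hB : ∀ a, ‖u a‖ ≤ B) : LippmannSchwinger C s z f u := by
  have hg := finite_support_sub hf (finite_support_pert hC u)
  have h1 := sub_eq_iff_eq_add.mp (shift_freeRes_sub s hz hg)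
  rw [LippmannSchwinger, ← sub_eq_zero]
  refine eq_zero_of_shift_eq_smul hz (by rcases hs with h | h; exacts [h.2.ne, h.2.ne']) ?_
    (B := B + ∑' b, ‖(f - pert C u) b‖) fun a => ?_
  · have h2 : shift (u - freeRes s z (f - pert C u)) =
        shift u - shift (freeRes s z (f - pert C u)) := rfl
    have h3 : shift u = z • u + f - pert C u := by rw [← hu, walk_eq]; abel
    rw [h2, h3, h1, smul_sub]
    abel
  · refine (norm_sub_le _ _).trans (add_le_add (hB a) (norm_freeRes_le ?_ hg a))
    exact hs.imp (fun h => ⟨h.1, h.2.le⟩) fun h => ⟨h.1, h.2.le⟩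

/-! ### The boundary values -/

/-- The matrix `1 + R₀ V` on the square `D`. -/
noncomputable def lsMatrix (C : Coin) (n₀ : ℕ) (s : ℝ) (z : ℂ) :
    Matrix (boxFinset n₀) (boxFinset n₀) ℂ :=
  Matrix.of fun i j => (if i = j then 1 else 0) +
    freeRes s z (pert C (Pi.single (j : Chirality × (ℤ × ℤ)) 1)) i

theorem lsMatrix_mulVec (C : Coin) (n₀ : ℕ) (s : ℝ) (z : ℂ) (w : Seq) (i : boxFinset n₀) :
    (lsMatrix C n₀ s z).mulVec (fun j => w j) i =
      w i + ∑ b ∈ boxFinset n₀, w b * freeRes s z (pert C (Pi.single b 1)) i := by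
  rw [← Finset.sum_coe_sort (boxFinset n₀)]
  simp [lsMatrix, Matrix.mulVec, dotProduct, mul_add, Finset.sum_add_distrib, mul_comm _ (w _)]

/-- A kernel vector, extended by zero to `W`, agrees on D with -R₀VW. Since V sees only D, the
latter solves the homogeneous Lippmann–Schwinger equation, and so vanishes. -/
theorem det_lsMatrix_ne_zero {C : Coin} {n₀ : ℕ} (hC : C.Admissible n₀) {s : ℝ}
    (hs : s = 1 ∨ s = -1) {z : ℂ} (hz : ‖z‖ = 1) : (lsMatrix C n₀ s z).det ≠ 0 := by
  classical
  intro h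
  obtain ⟨w, hw0, hw⟩ := Matrix.exists_mulVec_eq_zero_iff.mpr h
  let W : Seq := fun a => if ha : a ∈ boxFinset n₀ then w ⟨a, ha⟩ else 0
  have hW : (fun j : boxFinset n₀ => W j) = w := by ext j; simp [W]
  have hu : ∀ i : boxFinset n₀, (-freeRes s z (pert C W)) i = W i := fun i => by
    have := lsMatrix_mulVec C n₀ s z W i
    rw [hW, hw] at this
    rw [pert_eq_sum hC W, freeRes_sum s z _ _
      fun b _ => finite_support_smul _ (finite_support_pert hC _)]
    simp only [freeRes_smul, Pi.neg_apply, Finset.sum_apply, Pi.smul_apply, smul_eq_mul]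
    rw [eq_comm, ← add_eq_zero_iff_eq_neg]
    exact this.symm
  have hpert : pert C (-freeRes s z (pert C W)) = pert C W := by
    refine (pert_eq_sum hC _).trans ((Finset.sum_congr rfl fun b hb => ?_).trans
      (pert_eq_sum hC W).symm)
    rw [hu ⟨b, hb⟩]
  have hLS : LippmannSchwinger C s z 0 (-freeRes s z (pert C W)) := by
    rw [LippmannSchwinger, hpert, zero_sub, freeRes_neg]
  have hzero := hLS.eq_zero hC hs hz
  refine hw0 (funext fun j => ?_)
  rw [← hW]
  change W j = 0
  rw [← hu j, hzero]
  rfl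

/-- The values on D come from the inverse matrix, which is continuous at `z₀` by the determinant
lemma; elsewhere they are finite combinations of free resolvents. -/
theorem tendsto_lippmannSchwinger {C : Coin} {n₀ : ℕ} (hC : C.Admissible n₀) {s : ℝ}
    (hs : s = 1 ∨ s = -1) {z₀ : ℂ} (hz₀ : ‖z₀‖ = 1) {f : Seq} (hf : f.support.Finite)
    {ι : Type} {l : Filter ι} [l.NeBot] {z : ι → ℂ} (hz : Tendsto z l (𝓝 z₀)) {u : ι → Seq}
    (hu : ∀ᶠ i in l, LippmannSchwinger C s (z i) f (u i)) :
    ∃ v, LippmannSchwinger C s z₀ f v ∧ ∀ a, Tendsto (fun i => u i a) l (𝓝 (v a)) := by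
  classical
  have hz0 : z₀ ≠ 0 := fun h => by simp [h] at hz₀
  have hres : ∀ {g : Seq}, g.support.Finite → ∀ a,
      Tendsto (fun i => freeRes s (z i) g a) l (𝓝 (freeRes s z₀ g a)) := fun hg a =>
    (continuousAt_freeRes s hz0 hg a).tendsto.comp hz
  have hM : Tendsto (fun i => lsMatrix C n₀ s (z i)) l (𝓝 (lsMatrix C n₀ s z₀)) := by
    refine tendsto_pi_nhds.mpr fun i => tendsto_pi_nhds.mpr fun j => ?_
    exact (hres (finite_support_pert hC _) i).const_add _
  have hdet := det_lsMatrix_ne_zero hC hs hz₀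
  have hinv : Tendsto (fun i => (lsMatrix C n₀ s (z i))⁻¹) l (𝓝 (lsMatrix C n₀ s z₀)⁻¹) := by
    refine (continuousAt_matrix_inv _ ?_).tendsto.comp hM
    rw [Ring.inverse_eq_inv']
    exact continuousAt_inv₀ hdet
  have hrhs : Tendsto (fun i (b : boxFinset n₀) => freeRes s (z i) f b) l
      (𝓝 fun b : boxFinset n₀ => freeRes s z₀ f b) :=
    tendsto_pi_nhds.mpr fun b => hres hf b
  set w₀ := (lsMatrix C n₀ s z₀)⁻¹.mulVec fun b : boxFinset n₀ => freeRes s z₀ f b with hw₀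
  have hw : Tendsto (fun i => (lsMatrix C n₀ s (z i))⁻¹.mulVec
      fun b : boxFinset n₀ => freeRes s (z i) f b) l (𝓝 w₀) := by
    refine tendsto_pi_nhds.mpr fun b => ?_
    exact tendsto_finsetSum _ fun c _ =>
      (tendsto_pi_nhds.mp (tendsto_pi_nhds.mp hinv b) c).mul (tendsto_pi_nhds.mp hrhs c)
  have hdet' : ∀ᶠ i in l, (lsMatrix C n₀ s (z i)).det ≠ 0 :=
    ((continuous_id.matrix_det.tendsto _).comp hM).eventually_ne hdet
  have hbox : ∀ b : boxFinset n₀, Tendsto (fun i => u i b) l (𝓝 (w₀ b)) := fun b => by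
    refine (tendsto_pi_nhds.mp hw b).congr' ?_
    filter_upwards [hdet', hu] with i hi hui
    have h1 : (lsMatrix C n₀ s (z i)).mulVec (fun j => u i j) =
        fun b : boxFinset n₀ => freeRes s (z i) f b := by
      ext c
      rw [lsMatrix_mulVec]
      have := congrFun (hui.eq_sub hC hf) c
      simp only [Pi.sub_apply, Finset.sum_apply, Pi.smul_apply, smul_eq_mul] at this
      exact eq_sub_iff_add_eq.mp this
    rw [← h1, Matrix.mulVec_mulVec, Matrix.nonsing_inv_mul _ (isUnit_iff_ne_zero.mpr hi),
      Matrix.one_mulVec]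
  let W : Seq := fun a => if ha : a ∈ boxFinset n₀ then w₀ ⟨a, ha⟩ else 0
  let v : Seq := freeRes s z₀ (f - pert C W)
  have hv : ∀ a, v a = freeRes s z₀ f a -
      ∑ b ∈ boxFinset n₀, W b * freeRes s z₀ (pert C (Pi.single b 1)) a := fun a => by
    simp only [v]
    rw [freeRes_sub s z₀ hf (finite_support_pert hC W), pert_eq_sum hC W, freeRes_sum s z₀ _ _
      fun b _ => finite_support_smul _ (finite_support_pert hC _)]
    simp only [freeRes_smul, Pi.sub_apply, Finset.sum_apply, Pi.smul_apply, smul_eq_mul]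
  have hlim : ∀ a, Tendsto (fun i => u i a) l (𝓝 (v a)) := fun a => by
    rw [hv]
    have : Tendsto (fun i => freeRes s (z i) f a -
        ∑ b ∈ boxFinset n₀, u i b * freeRes s (z i) (pert C (Pi.single b 1)) a) l
        (𝓝 (freeRes s z₀ f a -
          ∑ b ∈ boxFinset n₀, W b * freeRes s z₀ (pert C (Pi.single b 1)) a)) := by
      refine (hres hf a).sub (tendsto_finsetSum _ fun b hb => ?_)
      have hWb : W b = w₀ ⟨b, hb⟩ := by simp only [W, dif_pos hb]
      rw [hWb]
      exact (hbox ⟨b, hb⟩).mul (hres (finite_support_pert hC _) a)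
    refine this.congr' ?_
    filter_upwards [hu] with i hi
    have := congrFun (hi.eq_sub hC hf) a
    simp only [Pi.sub_apply, Finset.sum_apply, Pi.smul_apply, smul_eq_mul] at this
    exact this.symm
  refine ⟨v, ?_, hlim⟩
  -- Consistency: `v` was built from `W`, and both equal the limit `w₀` on D.
  have hpert : pert C v = pert C W := by
    rw [pert_eq_sum hC, pert_eq_sum hC W]
    refine Finset.sum_congr rfl fun b hb => ?_
    have hWb : W b = w₀ ⟨b, hb⟩ := by simp only [W, dif_pos hb]
    rw [tendsto_nhds_unique (hlim b) (hbox ⟨b, hb⟩), hWb]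
  rw [LippmannSchwinger, hpert]

/-! ### Sequences supported in strips and the spaces `𝓑`, `𝓑^*` -/

theorem abs_lt_of_mem_shell {j : ℕ} {t : ℤ} (h : t ∈ shell j) : |t| < 2 ^ j := by
  cases j with
  | zero => simpa [shell] using h
  | succ j => exact h.2

theorem exists_mem_shell (t : ℤ) : ∃ j, t ∈ shell j := by
  rcases eq_or_ne t 0 with rfl | ht
  · exact ⟨0, by simp [shell]⟩
  · have hn : t.natAbs ≠ 0 := by omega
    refine ⟨Nat.log 2 t.natAbs + 1, ?_, ?_⟩ <;> rw [Int.abs_eq_natAbs]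
    · exact_mod_cast Nat.pow_log_le_self 2 hn
    · exact_mod_cast Nat.lt_pow_succ_log_self one_lt_two t.natAbs

/-- The part of the strips of half width `N` at distance less than `2 ^ j` from the origin. -/
noncomputable def stripFinset (N j : ℕ) : Finset (Chirality × (ℤ × ℤ)) :=
  ((Finset.univ : Finset Chirality) ×ˢ
    (Finset.Ioo (-2 ^ j : ℤ) (2 ^ j) ×ˢ Finset.Icc (-N : ℤ) N)).image
      fun a => (a.1, a.1.site a.2.1 a.2.2)

theorem mem_stripFinset {N j : ℕ} {a : Chirality × (ℤ × ℤ)} (h1 : a.1.along a.2 ∈ shell j)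
    (h2 : |a.1.across a.2| ≤ N) : a ∈ stripFinset N j := by
  refine Finset.mem_image.mpr ⟨(a.1, a.1.along a.2, a.1.across a.2), ?_, ?_⟩
  · simpa using ⟨abs_lt.mp (abs_lt_of_mem_shell h1), abs_le.mp h2⟩
  · rw [Chirality.site_along_across]

theorem card_stripFinset_le (N j : ℕ) :
    ((stripFinset N j).card : ℝ≥0∞) ≤ (8 * (2 * N + 1) : ℕ) * 2 ^ j := by
  have h : (stripFinset N j).card ≤ 8 * (2 * N + 1) * 2 ^ j := by
    refine Finset.card_image_le.trans ?_
    rw [Finset.card_product, Finset.card_product, Int.card_Ioo, Int.card_Icc]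
    have h4 : (Finset.univ : Finset Chirality).card = 4 := rfl
    have h1 : ((2 : ℤ) ^ j - -2 ^ j - 1).toNat ≤ 2 * 2 ^ j := by
      refine Int.toNat_le.mpr ?_
      push_cast
      omega
    have h2 : ((N : ℤ) + 1 - -N).toNat = 2 * N + 1 := by omega
    rw [h4, h2]
    calc 4 * (((2 : ℤ) ^ j - -2 ^ j - 1).toNat * (2 * N + 1))
        ≤ 4 * (2 * 2 ^ j * (2 * N + 1)) := by gcongr
      _ = _ := by ring
  exact_mod_cast h

/-- A shell meets the strips in O(2^j) points, so a bounded sequence has a_j = O(2^{j/2}), exactly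
the growth allowed in 𝓑^*. -/
theorem mem_spaceBDual_of_strip {u : Seq} {N : ℕ} (hu : ∀ a, u a ≠ 0 → |a.1.across a.2| ≤ N)
    {M : ℝ} (hM : ∀ a, ‖u a‖ ≤ M) : u ∈ spaceBDual := by
  let K : ℝ≥0∞ := (8 * (2 * N + 1) : ℕ) * ENNReal.ofReal M ^ 2
  have hK : K ≠ ∞ := ENNReal.mul_ne_top (ENNReal.natCast_ne_top _)
    (ENNReal.pow_ne_top ENNReal.ofReal_ne_top)
  refine lt_of_le_of_lt (iSup_le fun j => ?_)
    (ENNReal.rpow_lt_top_of_nonneg (y := 1 / 2) (by norm_num) hK)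
  have hsum : ∑' a : Chirality × (ℤ × ℤ),
      {b : Chirality × (ℤ × ℤ) | b.1.along b.2 ∈ shell j}.indicator (fun b => ‖u b‖ₑ ^ 2) a ≤
      K * 2 ^ j := by
    rw [tsum_eq_sum (s := stripFinset N j)]
    · refine (Finset.sum_le_card_nsmul _ _ (ENNReal.ofReal M ^ 2) fun a _ => ?_).trans ?_
      · refine (Set.indicator_le_self _ _ _).trans ?_
        gcongr
        rw [← ofReal_norm]
        exact ENNReal.ofReal_le_ofReal (hM a)
      · rw [nsmul_eq_mul]
        refine (mul_le_mul_left (card_stripFinset_le N j) _).trans_eq ?_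
        simp only [K]
        ring
    · intro a ha
      by_contra h
      rw [Set.indicator_apply_eq_zero, Classical.not_imp] at h
      obtain ⟨h1, h2⟩ := h
      exact ha (mem_stripFinset h1 (hu a fun h0 => by simp [h0] at h2))
  have h2j : (2 ^ j : ℝ≥0∞) ^ (1 / 2 : ℝ) ≠ 0 := by simp
  have h2j' : (2 ^ j : ℝ≥0∞) ^ (1 / 2 : ℝ) ≠ ∞ :=
    ENNReal.rpow_ne_top_of_nonneg (by norm_num) (by finiteness)
  calc (2 ^ j : ℝ≥0∞) ^ (-(1 / 2) : ℝ) * shellNorm j u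
      ≤ (2 ^ j : ℝ≥0∞) ^ (-(1 / 2) : ℝ) * (K * 2 ^ j) ^ (1 / 2 : ℝ) := by
        gcongr
        exact ENNReal.rpow_le_rpow hsum (by norm_num)
    _ = K ^ (1 / 2 : ℝ) := by
        rw [ENNReal.mul_rpow_of_nonneg _ _ (by norm_num), ENNReal.rpow_neg, mul_left_comm,
          ENNReal.inv_mul_cancel h2j h2j', mul_one]

/-- Elements of 𝓑 are ℓ¹ on strips: Cauchy–Schwarz on each shell costs the square root of its O(2^j)
points, which is the weight in 𝓑. This supplies the majorant for weak-* convergence. -/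
theorem summable_strip {g : Seq} (hg : g ∈ spaceB) (N : ℕ) :
    Summable fun a : Chirality × (ℤ × ℤ) => if |a.1.across a.2| ≤ N then ‖g a‖ else 0 := by
  let w : Chirality × (ℤ × ℤ) → ℝ≥0∞ := fun a => if |a.1.across a.2| ≤ N then ‖g a‖ₑ else 0
  let A : ℕ → Set (Chirality × (ℤ × ℤ)) := fun j => {b | b.1.along b.2 ∈ shell j}
  let K : ℝ≥0∞ := (8 * (2 * N + 1) : ℕ)
  have hshell : ∀ j, ∑' a, (A j).indicator w a ≤
      K ^ (1 / 2 : ℝ) * ((2 ^ j : ℝ≥0∞) ^ (1 / 2 : ℝ) * shellNorm j g) := by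
    intro j
    rw [tsum_eq_sum (s := stripFinset N j)]
    · have hH := ENNReal.inner_le_Lp_mul_Lq (stripFinset N j) (fun _ => 1) ((A j).indicator w)
        Real.HolderConjugate.two_two
      simp only [one_mul, Finset.sum_const, nsmul_eq_mul, ENNReal.rpow_two, one_pow, mul_one] at hH
      refine hH.trans ?_
      rw [← mul_assoc, ← ENNReal.mul_rpow_of_nonneg K _ one_half_pos.le]
      refine mul_le_mul' (ENNReal.rpow_le_rpow (card_stripFinset_le N j) one_half_pos.le)
        (ENNReal.rpow_le_rpow ?_ one_half_pos.le)
      refine le_trans (Finset.sum_le_sum fun a _ => ?_) (ENNReal.sum_le_tsum (stripFinset N j))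
      by_cases ha : a ∈ A j
      · rw [Set.indicator_of_mem ha, Set.indicator_of_mem (show a ∈ {b | _} from ha)]
        simp only [w]
        split_ifs <;> simp
      · rw [Set.indicator_of_notMem ha]
        simp
    · intro a ha
      by_contra h
      rw [Set.indicator_apply_eq_zero, Classical.not_imp] at h
      obtain ⟨h1, h2⟩ := h
      refine ha (mem_stripFinset h1 ?_)
      by_contra h3
      simp [w, h3] at h2
  have htop : ∑' a, w a ≠ ∞ := by
    refine ne_top_of_le_ne_top (b := K ^ (1 / 2 : ℝ) *
      ∑' j : ℕ, (2 ^ j : ℝ≥0∞) ^ (1 / 2 : ℝ) * shellNorm j g) ?_ ?_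
    · exact ENNReal.mul_ne_top
        (ENNReal.rpow_ne_top_of_nonneg (by norm_num) (ENNReal.natCast_ne_top _)) (ne_of_lt hg)
    · calc ∑' a, w a ≤ ∑' a, ∑' j, (A j).indicator w a := ENNReal.tsum_le_tsum fun a => by
            obtain ⟨j, hj⟩ := exists_mem_shell (a.1.along a.2)
            refine le_trans ?_ (ENNReal.le_tsum j)
            rw [Set.indicator_of_mem (show a ∈ A j from hj)]
        _ = ∑' j, ∑' a, (A j).indicator w a := ENNReal.tsum_comm
        _ ≤ _ := by
            rw [← ENNReal.tsum_mul_left]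
            exact ENNReal.tsum_le_tsum hshell
  refine (ENNReal.summable_toReal htop).congr fun a => ?_
  simp only [w]
  split_ifs <;> simp

/-- Point masses are admissible test sequences, so a weak-* limit is determined by its pointwise
values. -/
theorem single_mem_spaceB (a : Chirality × (ℤ × ℤ)) : (Pi.single a 1 : Seq) ∈ spaceB := by
  classical
  have hle : ∀ j, shellNorm j (Pi.single a 1) ≤ 1 := fun j => by
    refine (ENNReal.rpow_le_rpow (z := 1 / 2) (y := 1) ?_ (by norm_num)).trans_eq
      (ENNReal.one_rpow _)
    rw [tsum_eq_single a fun b hb => by simp [Set.indicator_apply, hb]]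
    refine (Set.indicator_le_self _ _ _).trans ?_
    simp
  have hzero : ∀ j, a.1.along a.2 ∉ shell j → shellNorm j (Pi.single a 1) = 0 := fun j hj => by
    rw [shellNorm, ENNReal.rpow_eq_zero_iff_of_pos (by norm_num), ENNReal.tsum_eq_zero]
    intro b
    rw [Set.indicator_apply_eq_zero]
    intro hb
    have : b ≠ a := by rintro rfl; exact hj hb
    simp [this]
  have hsup : ∀ j ∉ Finset.range ((a.1.along a.2).natAbs + 2),
      (2 ^ j : ℝ≥0∞) ^ (1 / 2 : ℝ) * shellNorm j (Pi.single a 1) = 0 := by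
    intro j hj
    rw [hzero j, mul_zero]
    intro hmem
    obtain ⟨k, rfl⟩ : ∃ k, j = k + 1 := ⟨j - 1, by simp at hj; omega⟩
    have h1 := hmem.1
    have h2 : (k : ℤ) < 2 ^ k := by exact_mod_cast Nat.lt_two_pow_self
    rw [Int.abs_eq_natAbs] at h1
    simp at hj
    omega
  change ∑' j : ℕ, _ < ∞
  rw [tsum_eq_sum hsup]
  refine ENNReal.sum_lt_top.mpr fun j _ => ENNReal.mul_lt_top ?_ ((hle j).trans_lt (by simp))
  exact ENNReal.rpow_lt_top_of_nonneg (by norm_num) (by finiteness)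

/-! ### Existence and characterization of the boundary values of the resolvent -/

theorem pairing_single (u : Seq) (a : Chirality × (ℤ × ℤ)) : pairing u (Pi.single a 1) = u a := by
  classical
  rw [pairing, tsum_eq_single a fun b hb => by simp [hb]]
  simp

theorem IsResolventLimit.unique {C : Coin} {θ s : ℝ} {f u v : Seq}
    (hu : IsResolventLimit C θ s f u) (hv : IsResolventLimit C θ s f v) : u = v := by
  ext a
  have := tendsto_nhds_unique (hu.2 _ (single_mem_spaceB a)) (hv.2 _ (single_mem_spaceB a))
  rwa [pairing_single, pairing_single] at this

theorem exp_kappa {θ s ε : ℝ} (h : 0 < 1 - s * ε) :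
    Complex.exp (Complex.I * kappa θ s ε) = Complex.exp (Complex.I * θ) * ((1 - s * ε : ℝ) : ℂ) := by
  have : Complex.I * kappa θ s ε = Complex.I * θ + (Real.log (1 - s * ε) : ℂ) := by
    rw [kappa, mul_sub, ← mul_assoc, Complex.I_mul_I]
    ring
  rw [this, Complex.exp_add, ← Complex.ofReal_exp, Real.exp_log h]

theorem norm_exp_I_mul (θ : ℝ) : ‖Complex.exp (Complex.I * θ)‖ = 1 := by
  rw [mul_comm, Complex.norm_exp_ofReal_mul_I]

/-- The limiting absorption principle for finitely supported sequences. -/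
theorem exists_isResolventLimit {C : Coin} {n₀ : ℕ} (hC : C.Admissible n₀) (θ : ℝ) {s : ℝ}
    (hs : s = 1 ∨ s = -1) {f : Seq} (hf : f.support.Finite) :
    ∃ u, IsResolventLimit C θ s f u ∧ LippmannSchwinger C s (Complex.exp (Complex.I * θ)) f u := by
  let z : ℝ → ℂ := fun ε => Complex.exp (Complex.I * kappa θ s ε)
  have hε : ∀ᶠ ε : ℝ in 𝓝[>] 0, 0 < ε ∧ ε < 1 := by
    filter_upwards [Ioo_mem_nhdsGT (zero_lt_one (α := ℝ))] with ε hε using hε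
  have hpos : ∀ {ε : ℝ}, 0 < ε ∧ ε < 1 → 0 < 1 - s * ε := by
    rintro ε ⟨h0, h1⟩
    rcases hs with rfl | rfl <;> linarith
  have hnorm : ∀ {ε : ℝ}, 0 < ε ∧ ε < 1 → ‖z ε‖ = 1 - s * ε := fun h => by
    simp only [z]
    rw [exp_kappa (hpos h), norm_mul, norm_exp_I_mul, one_mul, Complex.norm_real,
      Real.norm_of_nonneg (hpos h).le]
  have hside : ∀ {ε : ℝ}, 0 < ε ∧ ε < 1 → (s = 1 ∧ ‖z ε‖ < 1) ∨ (s = -1 ∧ 1 < ‖z ε‖) := fun h => by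
    rw [hnorm h]
    rcases hs with rfl | rfl
    · exact Or.inl ⟨rfl, by linarith [h.1]⟩
    · exact Or.inr ⟨rfl, by linarith [h.1]⟩
  have hz : Tendsto z (𝓝[>] 0) (𝓝 (Complex.exp (Complex.I * θ))) := by
    have h1 : Tendsto (fun ε : ℝ => Complex.exp (Complex.I * θ) * ((1 - s * ε : ℝ) : ℂ)) (𝓝[>] 0)
        (𝓝 (Complex.exp (Complex.I * θ) * ((1 - s * 0 : ℝ) : ℂ))) := by
      refine Tendsto.mono_left (Continuous.tendsto (by fun_prop) _) nhdsWithin_le_nhds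
    rw [mul_zero, sub_zero, Complex.ofReal_one, mul_one] at h1
    refine h1.congr' ?_
    filter_upwards [hε] with ε h
    exact (exp_kappa (hpos h)).symm
  have hLS : ∀ᶠ ε : ℝ in 𝓝[>] 0,
      LippmannSchwinger C s (z ε) f (resolventSeq C (kappa θ s ε) f) := by
    filter_upwards [hε] with ε h
    have hne : ‖z ε‖ ≠ 1 := by rcases hside h with h | h; exacts [h.2.ne, h.2.ne']
    obtain ⟨B, hB⟩ := exists_norm_resolventSeq_le C (kappa θ s ε) hf
    exact lippmannSchwinger_of_bounded hC (Complex.exp_ne_zero _) (hside h) hf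
      (walk_resolventSeq C hne hf) hB
  obtain ⟨u, hu, hlim⟩ := tendsto_lippmannSchwinger hC hs (norm_exp_I_mul θ) hf hz hLS
  -- a bound that is uniform in `ε`
  let M : ℝ := ∑' b, ‖f b‖ + ∑ b ∈ boxFinset n₀,
    (‖u b‖ + 1) * ∑' c, ‖pert C (Pi.single b 1) c‖
  have hbound : ∀ {ζ : ℂ} {v : Seq}, ((s = 1 ∧ ‖ζ‖ ≤ 1) ∨ (s = -1 ∧ 1 ≤ ‖ζ‖)) →
      LippmannSchwinger C s ζ f v → (∀ b ∈ boxFinset n₀, ‖v b‖ ≤ ‖u b‖ + 1) → ∀ a, ‖v a‖ ≤ M := by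
    intro ζ v hζ hv hvb a
    have := congrFun (hv.eq_sub hC hf) a
    rw [this, Pi.sub_apply, Finset.sum_apply]
    refine (norm_sub_le _ _).trans (add_le_add (norm_freeRes_le hζ hf a) ?_)
    refine (norm_sum_le _ _).trans (Finset.sum_le_sum fun b hb => ?_)
    rw [Pi.smul_apply, norm_smul]
    exact mul_le_mul (hvb b hb) (norm_freeRes_le hζ (finite_support_pert hC _) a) (norm_nonneg _)
      (by positivity)
  obtain ⟨N, hN⟩ := exists_support_subset_box hf
  have hstrip : ∀ {ζ : ℂ} {v : Seq}, LippmannSchwinger C s ζ f v → ∀ a, v a ≠ 0 →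
      |a.1.across a.2| ≤ (max N n₀ : ℕ) := by
    intro ζ v hv a ha
    rw [hv] at ha
    refine freeRes_across s ζ (fun b hb => ?_) ha
    by_cases h : f b = 0
    · have : pert C v b ≠ 0 := by simpa [h] using hb
      exact (pert_across hC this).trans (by exact_mod_cast le_max_right _ _)
    · exact (b.1.mem_box_iff.mp (hN b h)).2.trans (by exact_mod_cast le_max_left _ _)
  refine ⟨u, ⟨mem_spaceBDual_of_strip (hstrip hu) (hbound ?_ hu fun b _ => by linarith),
    fun g hg => ?_⟩, hu⟩
  · rw [norm_exp_I_mul]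
    exact hs.imp (fun h => ⟨h, le_rfl⟩) fun h => ⟨h, le_rfl⟩
  -- Domination uses that all the resolvents live in one common strip and are eventually bounded by
  -- `M`; the bound follows from convergence on the finite set D.
  · refine tendsto_tsum_of_dominated_convergence
      ((summable_strip hg (max N n₀)).mul_left M) (fun a => (hlim a).mul_const _) ?_
    have hbox : ∀ᶠ ε : ℝ in 𝓝[>] 0, ∀ b ∈ boxFinset n₀,
        ‖resolventSeq C (kappa θ s ε) f b‖ ≤ ‖u b‖ + 1 :=
      (Finset.eventually_all _).mpr fun b _ =>
        ((hlim b).norm.eventually (gt_mem_nhds (lt_add_one _))).mono fun _ h => h.le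
    filter_upwards [hε, hLS, hbox] with ε h1 h2 h3 a
    rw [norm_mul, RCLike.norm_conj]
    split_ifs with ha
    · refine mul_le_mul_of_nonneg_right (hbound ?_ h2 h3 a) (norm_nonneg _)
      exact (hside h1).imp (fun h => ⟨h.1, h.2.le⟩) fun h => ⟨h.1, h.2.le⟩
    · have : resolventSeq C (kappa θ s ε) f a = 0 := by
        by_contra h
        exact ha (hstrip h2 a h)
      simp [this]

theorem lippmannSchwinger_resolventLim {C : Coin} {n₀ : ℕ} (hC : C.Admissible n₀) (θ : ℝ) {s : ℝ}
    (hs : s = 1 ∨ s = -1) {f : Seq} (hf : f.support.Finite) :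
    LippmannSchwinger C s (Complex.exp (Complex.I * θ)) f (resolventLim C θ s f) := by
  obtain ⟨u, hu, hLS⟩ := exists_isResolventLimit hC θ hs hf
  have h : ∃ u, IsResolventLimit C θ s f u := ⟨u, hu⟩
  rw [resolventLim, dif_pos h, h.choose_spec.unique hu]
  exact hLS

/-! ### Adjoints -/

theorem pertAdj_ne_zero {C : Coin} {n₀ : ℕ} (hC : C.Admissible n₀) {u : Seq}
    {a : Chirality × (ℤ × ℤ)} (h : pertAdj C u a ≠ 0) : a.2 ∈ box n₀ := by
  by_contra hb
  rw [pertAdj_apply, coinAdjMul_eq_self (hC.eq_one _ hb), sub_self] at h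
  exact h rfl

theorem finite_support_pertAdj {C : Coin} {n₀ : ℕ} (hC : C.Admissible n₀) (u : Seq) :
    (pertAdj C u).support.Finite :=
  finite_support_of_box fun _ ha => pertAdj_ne_zero hC ha

/-- After the shift is moved across, both sides are finite sums over D, so no decay of `v` or `u` is
needed. -/
theorem tsum_mul_conj_pert {C : Coin} {n₀ : ℕ} (hC : C.Admissible n₀) (v u : Seq) :
    ∑' a, v a * conj (pert C u a) = ∑' a, pertAdj C v a * conj (u a) := by
  have h1 : ∑' a, v a * conj (pert C u a) =
      ∑' a, shiftInv v a * conj (coinMul C u a - u a) := by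
    rw [← shiftEquiv.tsum_eq fun a => shiftInv v a * conj (coinMul C u a - u a)]
    refine tsum_congr fun a => ?_
    simp [shiftInv, shiftEquiv, pert_apply]
  rw [h1, tsum_prod_swap, tsum_prod_swap]
  · refine tsum_congr fun x => ?_
    simp only [pertAdj_apply, coinAdjMul, coinMul, map_sub, map_sum, map_mul, mul_sub, sub_mul,
      Finset.sum_sub_distrib, Finset.mul_sum, Finset.sum_mul]
    rw [Finset.sum_comm]
    congr 1
    refine Finset.sum_congr rfl fun p _ => Finset.sum_congr rfl fun q _ => ?_
    ring
  · exact (finite_support_pertAdj hC v).subset fun a ha => left_ne_zero_of_mul ha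
  · refine finite_support_of_box (N := n₀) fun a ha => ?_
    by_contra hb
    rw [coinMul_eq_self (hC.eq_one _ hb)] at ha
    simp at ha

/-- An outgoing and an incoming solution overlap on a finite set only. -/
theorem finite_support_mul_conj {z : ℂ} {f g : Seq} (hf : f.support.Finite) (hg : g.support.Finite) :
    (fun a => freeRes (-1) z f a * conj (freeRes 1 z g a)).support.Finite := by
  obtain ⟨M, hM⟩ := exists_support_subset_box hf
  obtain ⟨N, hN⟩ := exists_support_subset_box hg
  refine finite_support_of_box (N := max M N) fun a ha => ?_
  obtain ⟨p, x⟩ := a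
  obtain ⟨m, hm0, hm⟩ := exists_of_freeRes_ne_zero (left_ne_zero_of_mul ha)
  have hg0 : freeRes 1 z g (p, x) ≠ 0 := fun h => right_ne_zero_of_mul ha (by simp [h])
  obtain ⟨n, hn0, hn⟩ := exists_of_freeRes_ne_zero hg0
  have hm1 := ((outCoef_ne_zero (Or.inr rfl)).mp hm0).resolve_left (by norm_num)
  have hn1 := ((outCoef_ne_zero (Or.inl rfl)).mp hn0).resolve_right (by norm_num)
  have h1 := p.mem_box_iff.mp (hM _ hm)
  have h2 := p.mem_box_iff.mp (hN _ hn)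
  simp only [Chirality.along_sub_smul, Chirality.across_sub_smul, abs_le] at h1 h2
  rw [p.mem_box_iff, abs_le, abs_le]
  push_cast
  rcases p.sgn_eq with e | e <;> rw [e] at h1 h2 <;> omega

/-- The relation `R(θ + i0)^* = - e^{iθ} (1 + e^{iθ} R(θ - i0))` in the form of a pairing. -/
theorem tsum_mul_conj_lippmannSchwinger {C : Coin} {n₀ : ℕ} (hC : C.Admissible n₀) {z : ℂ}
    (hz : ‖z‖ = 1) {h u w : Seq} (hh : h.support.Finite) (a : Chirality × (ℤ × ℤ))
    (hu : LippmannSchwinger C 1 z (Pi.single a 1) u) (hw : LippmannSchwinger C (-1) z h w) :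
    ∑' c, h c * conj (u c) = -(z * h a + z ^ 2 * w a) := by
  classical
  have hz0 : z ≠ 0 := fun h => by simp [h] at hz
  have hzz : z * conj z = 1 := by rw [Complex.mul_conj', hz]; norm_num
  have hsup : (fun c => w c * conj (u c)).support.Finite := by
    have := finite_support_mul_conj (z := z) (finite_support_sub hh (finite_support_pert hC w))
      (finite_support_sub (finite_support_single a) (finite_support_pert hC u))
    rwa [← hw, ← hu] at this
  have hiso := tsum_walk_mul_conj hC hsup
  -- Expanding (zw + h, zu + δ_a) = (w, u) cancels the term (w, u) because |z| = 1; multiplying the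
  -- rest by `z` isolates (h, u).
  rw [hw.walk_eq hC hz0 hh, hu.walk_eq hC hz0 (finite_support_single a)] at hiso
  have s1 : HasSum (fun c => w c * conj (u c)) (∑' c, w c * conj (u c)) :=
    (summable_of_hasFiniteSupport hsup).hasSum
  have s2 : HasSum (fun c => h c * conj (u c)) (∑' c, h c * conj (u c)) :=
    (summable_of_hasFiniteSupport (hh.subset fun c hc => left_ne_zero_of_mul hc)).hasSum
  have s3 : ∀ v : Seq, HasSum (fun c => v c * conj ((Pi.single a 1 : Seq) c)) (v a) := fun v => by
    have := hasSum_single (f := fun c => v c * conj ((Pi.single a 1 : Seq) c)) a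
      fun b hb => by simp [hb]
    simpa using this
  have hs := ((s1.add ((s3 w).mul_left z)).add (s2.mul_left (conj z))).add (s3 h)
  have heq : (fun c => (z • w + h : Seq) c * conj ((z • u + Pi.single a 1 : Seq) c)) = fun c =>
      w c * conj (u c) + z * (w c * conj ((Pi.single a 1 : Seq) c)) +
        conj z * (h c * conj (u c)) + h c * conj ((Pi.single a 1 : Seq) c) := by
    ext c
    simp only [Pi.add_apply, Pi.smul_apply, smul_eq_mul, map_add, map_mul]
    linear_combination (w c * conj (u c)) * hzz
  rw [heq, hs.tsum_eq] at hiso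
  linear_combination z * hiso - (∑' c, h c * conj (u c)) * hzz

/-! ### The Fourier transform -/

theorem summable_fourier₀ (θ : ℝ) {f : Seq} (hf : f.support.Finite) (p : Chirality) (y : ℤ) :
    Summable fun t : ℤ => Complex.exp (-(Complex.I * (p.sgn * θ * t))) * f (p, p.site t y) := by
  refine summable_of_hasFiniteSupport
    ((hf.image fun a => a.1.along a.2).subset fun t ht => ?_)
  exact ⟨(p, p.site t y), right_ne_zero_of_mul ht, p.along_site t y⟩

theorem fourier₀_add (θ : ℝ) {f g : Seq} (hf : f.support.Finite) (hg : g.support.Finite)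
    (p : Chirality) (y : ℤ) : fourier₀ θ (f + g) p y = fourier₀ θ f p y + fourier₀ θ g p y := by
  unfold fourier₀
  rw [← mul_add, ← (summable_fourier₀ θ hf p y).tsum_add (summable_fourier₀ θ hg p y)]
  simp only [Pi.add_apply, mul_add]

theorem fourier₀_smul (θ : ℝ) (c : ℂ) (f : Seq) (p : Chirality) (y : ℤ) :
    fourier₀ θ (c • f) p y = c * fourier₀ θ f p y := by
  unfold fourier₀
  rw [mul_left_comm, ← tsum_mul_left (a := c)]
  simp only [Pi.smul_apply, smul_eq_mul, mul_left_comm]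

theorem fourier₀_sub (θ : ℝ) {f g : Seq} (hf : f.support.Finite) (hg : g.support.Finite)
    (p : Chirality) (y : ℤ) : fourier₀ θ (f - g) p y = fourier₀ θ f p y - fourier₀ θ g p y := by
  rw [sub_eq_add_neg, ← neg_one_smul ℂ g, fourier₀_add θ hf (finite_support_smul _ hg),
    fourier₀_smul]
  ring

theorem fourier₀_sum (θ : ℝ) (F : Finset (Chirality × (ℤ × ℤ))) (c : Chirality × (ℤ × ℤ) → ℂ)
    (p : Chirality) (y : ℤ) : fourier₀ θ (∑ b ∈ F, c b • (Pi.single b 1 : Seq)) p y =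
      ∑ b ∈ F, c b * fourier₀ θ (Pi.single b 1) p y := by
  classical
  induction F using Finset.induction_on with
  | empty => simp [fourier₀]
  | insert i F hi ih =>
    rw [Finset.sum_insert hi, Finset.sum_insert hi,
      fourier₀_add θ (finite_support_smul _ (finite_support_single i))
        (finite_support_sum F _ fun j _ => finite_support_smul _ (finite_support_single j)),
      fourier₀_smul, ih]

theorem exists_of_fourier₀_ne_zero {θ : ℝ} {f : Seq} {p : Chirality} {y : ℤ}
    (h : fourier₀ θ f p y ≠ 0) : ∃ t, f (p, p.site t y) ≠ 0 := by
  by_contra! h0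
  simp [fourier₀, h0] at h

theorem finite_support_fourier₀ (θ : ℝ) {f : Seq} (hf : f.support.Finite) :
    {b : Chirality × ℤ | fourier₀ θ f b.1 b.2 ≠ 0}.Finite := by
  refine (hf.image fun a => (a.1, a.1.across a.2)).subset fun b hb => ?_
  obtain ⟨t, ht⟩ := exists_of_fourier₀_ne_zero hb
  exact ⟨(b.1, b.1.site t b.2), ht, by simp [Chirality.across_site]⟩

theorem fourier₀_single_of_ne (θ : ℝ) {a : Chirality × (ℤ × ℤ)} {b : Chirality × ℤ}
    (h : b ≠ (a.1, a.1.across a.2)) : fourier₀ θ (Pi.single a 1) b.1 b.2 = 0 := by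
  classical
  by_contra h0
  obtain ⟨t, ht⟩ := exists_of_fourier₀_ne_zero h0
  have : (b.1, b.1.site t b.2) = a := by
    by_contra hne
    exact ht (Pi.single_eq_of_ne hne _)
  refine h ?_
  rw [← this]
  simp [Chirality.across_site]

theorem freeWave_apply (θ : ℝ) (φ : HSpace) (a : Chirality × (ℤ × ℤ)) :
    freeWave θ φ a = conj (fourier₀ θ (Pi.single a 1) a.1 (a.1.across a.2)) *
      φ (a.1, a.1.across a.2) := by
  rw [freeWave, adjSeq, tsum_eq_single (a.1, a.1.across a.2)]
  · ring
  · intro b hb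
    rw [fourier₀_single_of_ne θ hb, map_zero, mul_zero]

theorem summable_mul_conj_fourier₀ (θ : ℝ) (φ : HSpace) {g : Seq} (hg : g.support.Finite) :
    Summable fun b : Chirality × ℤ => φ b * conj (fourier₀ θ g b.1 b.2) :=
  summable_of_hasFiniteSupport ((finite_support_fourier₀ θ hg).subset fun b hb h => by
    simp [h] at hb)

/-- `adjSeq` is defined by testing on point masses; linearity extends the adjoint relation to
finitely supported `g`. -/
theorem tsum_mul_conj_fourier₀ (θ : ℝ) (φ : HSpace) {g : Seq} (hg : g.support.Finite) :
    ∑' b : Chirality × ℤ, φ b * conj (fourier₀ θ g b.1 b.2) =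
      ∑' c, freeWave θ φ c * conj (g c) := by
  classical
  have hF : ∀ c, g c ≠ 0 → c ∈ hg.toFinset := fun c hc => hg.mem_toFinset.mpr hc
  have h1 : ∀ b : Chirality × ℤ, φ b * conj (fourier₀ θ g b.1 b.2) =
      ∑ c ∈ hg.toFinset, conj (g c) * (φ b * conj (fourier₀ θ (Pi.single c 1) b.1 b.2)) := by
    intro b
    conv_lhs => rw [eq_sum_single hF, fourier₀_sum]
    rw [map_sum, Finset.mul_sum]
    refine Finset.sum_congr rfl fun c _ => ?_
    rw [map_mul]
    ring
  simp_rw [h1]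
  rw [Summable.tsum_finsetSum fun c _ =>
    (summable_mul_conj_fourier₀ θ φ (finite_support_single c)).mul_left _]
  rw [tsum_eq_sum (s := hg.toFinset)]
  · refine Finset.sum_congr rfl fun c _ => ?_
    rw [tsum_mul_left, mul_comm]
    rfl
  · intro c hc
    have : g c = 0 := by simpa using hc
    simp [this]

/-- The free resolvent on the incoming side is a plane wave beyond the support. -/
theorem freeRes_neg_one_eq {θ : ℝ} {g : Seq} {m : ℤ} {a : Chirality × (ℤ × ℤ)}
    (hg : ∀ c, g c ≠ 0 → m ≤ c.1.sgn * c.1.along c.2) (ha : a.1.sgn * a.1.along a.2 ≤ m) :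
    freeRes (-1) (Complex.exp (Complex.I * θ)) g a =
      -((Complex.exp (Complex.I * θ))⁻¹ * (Real.sqrt (2 * Real.pi) : ℂ) *
        Complex.exp (Complex.I * (a.1.sgn * θ * a.1.along a.2)) *
        fourier₀ θ g a.1 (a.1.across a.2)) := by
  obtain ⟨p, x⟩ := a
  simp only at ha ⊢
  have hpi : (Real.sqrt (2 * Real.pi) : ℂ) ≠ 0 := by
    exact_mod_cast (Real.sqrt_pos.mpr (by positivity)).ne'
  let e : ℤ ≃ ℤ :=
    { toFun := fun n => p.along x - p.sgn * n
      invFun := fun t => p.sgn * (p.along x - t)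
      left_inv := fun n => by linear_combination n * p.sgn_mul_sgn
      right_inv := fun t => by linear_combination -(p.along x - t) * p.sgn_mul_sgn }
  have hterm : ∀ n : ℤ, outCoef (-1) n * Complex.exp (Complex.I * θ) ^ (n - 1) *
      g (p, x - n • p.step) = -((Complex.exp (Complex.I * θ))⁻¹ *
        Complex.exp (Complex.I * (p.sgn * θ * p.along x))) *
        (Complex.exp (-(Complex.I * (p.sgn * θ * (e n : ℤ)))) *
          g (p, p.site (e n) (p.across x))) := by
    intro n
    have hsite : p.site (e n) (p.across x) = x - n • p.step := p.site_eq_sub_smul x n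
    rw [hsite]
    by_cases h0 : g (p, x - n • p.step) = 0
    · simp only [h0, mul_zero]
    · have h1 := hg _ h0
      simp only [Chirality.along_sub_smul] at h1
      -- A step with `n ≥ 1` would lead below the level `m`, outside the support. Thus every nonzero
      -- term has coefficient -1 and the half-ray sum is the full Fourier sum.
      have hn : ¬ 1 ≤ n := by
        intro hn
        rcases p.sgn_eq with e | e <;> rw [e] at h1 ha <;> omega
      have hexp : Complex.exp (Complex.I * (p.sgn * θ * p.along x)) *
          Complex.exp (-(Complex.I * (p.sgn * θ * (e n : ℤ)))) =
          Complex.exp (Complex.I * θ) ^ n := by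
        rw [← Complex.exp_add, ← Complex.exp_int_mul]
        congr 1
        have hs : (p.sgn : ℂ) * p.sgn = 1 := by exact_mod_cast p.sgn_mul_sgn
        simp only [e, Equiv.coe_fn_mk]
        push_cast
        linear_combination (Complex.I * θ * n) * hs
      rw [outCoef_neg_one, if_neg hn, zpow_sub_one₀ (Complex.exp_ne_zero _), ← hexp]
      ring
  rw [freeRes, tsum_congr hterm, tsum_mul_left,
    e.tsum_eq fun t : ℤ => Complex.exp (-(Complex.I * (p.sgn * θ * t))) *
      g (p, p.site t (p.across x)), fourier₀]
  push_cast
  field_simp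

/-! ### The scattered wave and the operator `A(θ)` -/

section

variable {C : Coin} {n₀ : ℕ}

/-- At the site `a`, the scattered wave is -(F⁽⁰⁾^*φ, V R(θ + i0)δ_a) = -(h, R(θ + i0)δ_a) with h =
V^*F⁽⁰⁾^*φ; the adjoint relation turns this into R(θ - i0)h. -/
theorem scatteredWave_eq (hC : C.Admissible n₀) (θ : ℝ) (φ : HSpace) (a : Chirality × (ℤ × ℤ)) :
    scatteredWave C θ φ a = Complex.exp (Complex.I * θ) * pertAdj C (freeWave θ φ) a +
      Complex.exp (Complex.I * θ) ^ 2 *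
        resolventLim C θ (-1) (pertAdj C (freeWave θ φ)) a := by
  have hh := finite_support_pertAdj hC (freeWave θ φ)
  have hδ := finite_support_single a
  have hu := lippmannSchwinger_resolventLim hC θ (Or.inl rfl) hδ
  have hw := lippmannSchwinger_resolventLim hC θ (Or.inr rfl) hh
  have hV := finite_support_pert hC (resolventLim C θ 1 (Pi.single a 1))
  have hdist : distWave C θ φ a = freeWave θ φ a - ∑' b : Chirality × ℤ, φ b *
      conj (fourier₀ θ (pert C (resolventLim C θ 1 (Pi.single a 1))) b.1 b.2) := by
    rw [freeWave, distWave, adjSeq, adjSeq, ← (summable_mul_conj_fourier₀ θ φ hδ).tsum_sub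
      (summable_mul_conj_fourier₀ θ φ hV)]
    refine tsum_congr fun b => ?_
    rw [distFourier, fourier₀_sub θ hδ hV, map_sub, mul_sub]
  rw [scatteredWave, Pi.sub_apply, hdist, tsum_mul_conj_fourier₀ θ φ hV,
    tsum_mul_conj_pert hC, tsum_mul_conj_lippmannSchwinger hC (norm_exp_I_mul θ) hh a hu hw]
  ring

/-- The source `h - V R(θ - i0) h` of the scattered wave lives in the corridors. -/
theorem source_ne_zero (hC : C.Admissible n₀) {v w : Seq} {a : Chirality × (ℤ × ℤ)}
    (h : (pertAdj C v - pert C w) a ≠ 0) :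
    |a.1.across a.2| ≤ n₀ ∧ -(n₀ : ℤ) - 1 ≤ a.1.sgn * a.1.along a.2 := by
  by_cases h0 : pertAdj C v a = 0
  · have h1 : pert C w a ≠ 0 := by simpa [h0] using h
    have h2 := (a.1.mem_box_iff.mp (pert_ne_zero hC h1)).1
    refine ⟨pert_across hC h1, ?_⟩
    rw [Chirality.along_add_step, abs_le] at h2
    rcases a.1.sgn_eq with e | e <;> rw [e] at h2 ⊢ <;> omega
  · have h2 := a.1.mem_box_iff.mp (pertAdj_ne_zero hC h0)
    refine ⟨h2.2, ?_⟩
    rw [abs_le] at h2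
    rcases a.1.sgn_eq with e | e <;> rw [e] <;> omega

theorem scatA_eq_zero (hC : C.Admissible n₀) (θ : ℝ) (φ : HSpace) (p : Chirality) {y : ℤ}
    (hy : (n₀ : ℤ) + 1 ≤ |y|) : scatA C θ φ p y = 0 := by
  by_contra h
  obtain ⟨t, ht⟩ := exists_of_fourier₀_ne_zero h
  have := (source_ne_zero hC ht).1
  simp only [Chirality.across_site] at this
  omega

theorem scatteredWave_eq_zero (hC : C.Admissible n₀) (θ : ℝ) (φ : HSpace) (p : Chirality)
    {x : ℤ × ℤ} (hx : (n₀ : ℤ) + 1 ≤ |p.across x|) : scatteredWave C θ φ (p, x) = 0 := by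
  have hw := lippmannSchwinger_resolventLim hC θ (s := -1) (Or.inr rfl)
    (finite_support_pertAdj hC (freeWave θ φ))
  have h1 : pertAdj C (freeWave θ φ) (p, x) = 0 := by
    by_contra h
    have := (p.mem_box_iff.mp (pertAdj_ne_zero hC h)).2
    simp only at this
    omega
  have h2 : resolventLim C θ (-1) (pertAdj C (freeWave θ φ)) (p, x) = 0 := by
    by_contra h
    rw [hw] at h
    have := freeRes_across _ _ (N := n₀) (fun c hc => (source_ne_zero hC hc).1) h
    simp only at this
    omega
  rw [scatteredWave_eq hC, h1, h2, mul_zero, mul_zero, add_zero]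

theorem scatteredWave_eq_planeWave (hC : C.Admissible n₀) (θ : ℝ) (φ : HSpace) (p : Chirality)
    {x : ℤ × ℤ} (hx : p.sgn * p.along x ≤ -(n₀ : ℤ) - 1) :
    scatteredWave C θ φ (p, x) =
      -(Real.sqrt (2 * Real.pi) : ℂ) * Complex.exp (Complex.I * θ) *
        Complex.exp (Complex.I * (p.sgn * θ * p.along x)) *
        scatA C θ φ p (p.across x) := by
  have hw := lippmannSchwinger_resolventLim hC θ (s := -1) (Or.inr rfl)
    (finite_support_pertAdj hC (freeWave θ φ))
  have h1 : pertAdj C (freeWave θ φ) (p, x) = 0 := by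
    by_contra h
    have := (p.mem_box_iff.mp (pertAdj_ne_zero hC h)).1
    simp only [abs_le] at this
    rcases p.sgn_eq with e | e <;> rw [e] at hx <;> omega
  -- Here m = -n₀ - 1. The factor z⁻¹ in this plane wave meets the z² of `scatteredWave_eq`, leaving
  -- one e^{iθ}.
  have h2 := freeRes_neg_one_eq (θ := θ) (a := (p, x))
    (fun c hc => (source_ne_zero hC (v := freeWave θ φ)
      (w := resolventLim C θ (-1) (pertAdj C (freeWave θ φ))) hc).2) hx
  rw [← hw] at h2
  rw [scatteredWave_eq hC, h1, h2, scatA, distFourier]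
  have hz := Complex.exp_ne_zero (Complex.I * θ)
  field_simp
  ring

/-! ### Linearity, boundedness and finite rank of `A(θ)`. -/

theorem distFourier_add (hC : C.Admissible n₀) (θ : ℝ) {s : ℝ} (hs : s = 1 ∨ s = -1) {f g : Seq}
    (hf : f.support.Finite) (hg : g.support.Finite) (p : Chirality) (y : ℤ) :
    distFourier C θ s (f + g) p y = distFourier C θ s f p y + distFourier C θ s g p y := by
  -- `resolventLim` is defined by choice, so its additivity comes from uniqueness for the
  -- Lippmann–Schwinger equation.
  have h := (lippmannSchwinger_resolventLim hC θ hs (finite_support_add hf hg)).unique hC hs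
    (norm_exp_I_mul θ) (finite_support_add hf hg)
    ((lippmannSchwinger_resolventLim hC θ hs hf).add hC hf hg
      (lippmannSchwinger_resolventLim hC θ hs hg))
  unfold distFourier
  rw [h, pert_add, add_sub_add_comm, fourier₀_add θ
    (finite_support_sub hf (finite_support_pert hC _))
    (finite_support_sub hg (finite_support_pert hC _))]

theorem distFourier_smul (hC : C.Admissible n₀) (θ : ℝ) {s : ℝ} (hs : s = 1 ∨ s = -1) (c : ℂ)
    {f : Seq} (hf : f.support.Finite) (p : Chirality) (y : ℤ) :
    distFourier C θ s (c • f) p y = c * distFourier C θ s f p y := by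
  have h := (lippmannSchwinger_resolventLim hC θ hs (finite_support_smul c hf)).unique hC hs
    (norm_exp_I_mul θ) (finite_support_smul c hf)
    ((lippmannSchwinger_resolventLim hC θ hs hf).smul c)
  unfold distFourier
  rw [h, pert_smul, ← smul_sub, fourier₀_smul]

theorem distFourier_sum (hC : C.Admissible n₀) (θ : ℝ) {s : ℝ} (hs : s = 1 ∨ s = -1)
    (F : Finset (Chirality × (ℤ × ℤ))) (c : Chirality × (ℤ × ℤ) → ℂ) (p : Chirality) (y : ℤ) :
    distFourier C θ s (∑ b ∈ F, c b • (Pi.single b 1 : Seq)) p y =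
      ∑ b ∈ F, c b * distFourier C θ s (Pi.single b 1) p y := by
  classical
  induction F using Finset.induction_on with
  | empty =>
    have := distFourier_smul hC θ hs 0 (f := 0) (by simp) p y
    simpa using this
  | insert i F hi ih =>
    rw [Finset.sum_insert hi, Finset.sum_insert hi,
      distFourier_add hC θ hs (finite_support_smul _ (finite_support_single i))
        (finite_support_sum F _ fun j _ => finite_support_smul _ (finite_support_single j)),
      distFourier_smul hC θ hs _ (finite_support_single i), ih]

/-- The value of the free wave `u⁽⁰⁾` at a site, as a functional of `φ`. -/
noncomputable def freeWaveCLM (θ : ℝ) (a : Chirality × (ℤ × ℤ)) : HSpace →L[ℂ] ℂ :=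
  conj (fourier₀ θ (Pi.single a 1) a.1 (a.1.across a.2)) •
    lp.evalCLM ℂ (fun _ : Chirality × ℤ => ℂ) 2 (a.1, a.1.across a.2)

theorem freeWaveCLM_apply (θ : ℝ) (a : Chirality × (ℤ × ℤ)) (φ : HSpace) :
    freeWaveCLM θ a φ = freeWave θ φ a := by
  rw [freeWave_apply]
  rfl

/-- The value of `V^* u⁽⁰⁾` at a site, as a functional of `φ`. -/
noncomputable def pertAdjFreeWaveCLM (C : Coin) (θ : ℝ) (a : Chirality × (ℤ × ℤ)) :
    HSpace →L[ℂ] ℂ :=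
  ∑ q, conj ((C a.2 : Matrix Chirality Chirality ℂ) q a.1) • freeWaveCLM θ (q, a.2 - q.step) -
    freeWaveCLM θ (a.1, a.2 - a.1.step)

theorem pertAdjFreeWaveCLM_apply (C : Coin) (θ : ℝ) (a : Chirality × (ℤ × ℤ)) (φ : HSpace) :
    pertAdjFreeWaveCLM C θ a φ = pertAdj C (freeWave θ φ) a := by
  simp [pertAdjFreeWaveCLM, freeWaveCLM_apply, pertAdj_apply, coinAdjMul, shiftInv]

theorem scatA_eq_sum (hC : C.Admissible n₀) (θ : ℝ) (φ : HSpace) (p : Chirality) (y : ℤ) :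
    scatA C θ φ p y = ∑ a ∈ boxFinset n₀,
      pertAdjFreeWaveCLM C θ a φ * distFourier C θ (-1) (Pi.single a 1) p y := by
  have h := eq_sum_single (g := pertAdj C (freeWave θ φ)) (F := boxFinset n₀)
    fun a ha => mem_boxFinset.mpr (pertAdj_ne_zero hC ha)
  rw [scatA, h, distFourier_sum hC θ (Or.inr rfl)]
  simp only [pertAdjFreeWaveCLM_apply]

theorem exists_scatA_clm (hC : C.Admissible n₀) (θ : ℝ) :
    ∃ A : HSpace →L[ℂ] HSpace, (∀ φ p y, A φ (p, y) = scatA C θ φ p y) ∧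
      FiniteDimensional ℂ (LinearMap.range (A : HSpace →ₗ[ℂ] HSpace)) := by
  classical
  let G : Finset (Chirality × ℤ) := Finset.univ ×ˢ Finset.Icc (-(n₀ : ℤ)) n₀
  let e : Chirality × ℤ → HSpace := fun b => lp.single 2 b 1
  let L : Chirality × ℤ → HSpace →L[ℂ] ℂ := fun b => ∑ a ∈ boxFinset n₀,
    distFourier C θ (-1) (Pi.single a 1) b.1 b.2 • pertAdjFreeWaveCLM C θ a
  have hL : ∀ b φ, L b φ = scatA C θ φ b.1 b.2 := fun b φ => by
    rw [scatA_eq_sum hC]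
    simp [L, mul_comm]
  -- Finitely many coordinates suffice, since A(θ)φ vanishes off `G`; each is a continuous
  -- functional because V^*F⁽⁰⁾^*φ is evaluated only on D.
  let A : HSpace →L[ℂ] HSpace := ∑ b ∈ G, (L b).smulRight (e b)
  have hA : ∀ φ, A φ = ∑ b ∈ G, L b φ • e b := fun φ => by
    simp [A]
  refine ⟨A, fun φ p y => ?_, ?_⟩
  · rw [hA, lp.coeFn_sum, Finset.sum_apply]
    have hterm : ∀ b ∈ G, (L b φ • e b : HSpace) (p, y) = if (p, y) = b then L b φ else 0 := by
      intro b _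
      rw [lp.coeFn_smul, Pi.smul_apply, smul_eq_mul]
      simp only [e, lp.coeFn_single, Pi.single_apply, mul_ite, mul_one, mul_zero]
    rw [Finset.sum_congr rfl hterm, Finset.sum_ite_eq]
    split_ifs with hmem
    · exact hL _ _
    · refine (scatA_eq_zero hC θ φ p ?_).symm
      by_contra hlt
      refine hmem ?_
      simp only [G, Finset.mem_product, Finset.mem_univ, Finset.mem_Icc, true_and]
      exact abs_le.mp (by omega)
  · have hfin : FiniteDimensional ℂ (Submodule.span ℂ (e '' G)) :=
      FiniteDimensional.span_of_finite ℂ (G.finite_toSet.image e)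
    refine Submodule.finiteDimensional_of_le (S₂ := Submodule.span ℂ (e '' G)) ?_
    rintro _ ⟨φ, rfl⟩
    change A φ ∈ _
    rw [hA]
    exact Submodule.sum_mem _ fun b hb => Submodule.smul_mem _ _
      (Submodule.subset_span ⟨b, hb, rfl⟩)

end

end QWalk

theorem mainTheorem3 (C : QWalk.Coin) (n₀ : ℕ) (hn₀ : 0 < n₀) (hC : C.Admissible n₀)
    (θ : ℝ) (hθ : θ ∈ Set.Ico 0 (2 * Real.pi)) :
    -- the boundary values of the resolvent that enter the objects below exist
    (∀ s : ℝ, (s = 1 ∨ s = -1) → ∀ f : QWalk.Seq, f.support.Finite →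
      ∃ u, QWalk.IsResolventLimit C θ s f u) ∧
    -- the components of `A(θ) φ` vanish off the corridors
    (∀ φ : QWalk.HSpace,
      (∀ x₂ : ℤ, (n₀ : ℤ) + 1 ≤ |x₂| →
        QWalk.scatA C θ φ .left x₂ = 0 ∧ QWalk.scatA C θ φ .right x₂ = 0) ∧
      (∀ x₁ : ℤ, (n₀ : ℤ) + 1 ≤ |x₁| →
        QWalk.scatA C θ φ .down x₁ = 0 ∧ QWalk.scatA C θ φ .up x₁ = 0)) ∧
    -- `A(θ)` is a bounded operator of finite rank on `𝐡(θ)`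
    (∃ A : QWalk.HSpace →L[ℂ] QWalk.HSpace,
      (∀ φ p y, A φ (p, y) = QWalk.scatA C θ φ p y) ∧
      FiniteDimensional ℂ (LinearMap.range (A : QWalk.HSpace →ₗ[ℂ] QWalk.HSpace))) ∧
    -- the scattered wave vanishes off the corridors, and is an outgoing plane wave along them
    (∀ (φ : QWalk.HSpace) (p : QWalk.Chirality) (x : ℤ × ℤ),
      ((n₀ : ℤ) + 1 ≤ |p.across x| → QWalk.scatteredWave C θ φ (p, x) = 0) ∧
      (p.sgn * p.along x ≤ -(n₀ : ℤ) - 1 →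
        QWalk.scatteredWave C θ φ (p, x) =
          -(Real.sqrt (2 * Real.pi) : ℂ) * Complex.exp (Complex.I * θ) *
            Complex.exp (Complex.I * (p.sgn * θ * p.along x)) *
            QWalk.scatA C θ φ p (p.across x))) :=
  ⟨fun _ hs _ hf => (QWalk.exists_isResolventLimit hC θ hs hf).imp fun _ h => h.1,
    fun φ => ⟨fun _ hy => ⟨QWalk.scatA_eq_zero hC θ φ _ hy, QWalk.scatA_eq_zero hC θ φ _ hy⟩,
      fun _ hy => ⟨QWalk.scatA_eq_zero hC θ φ _ hy, QWalk.scatA_eq_zero hC θ φ _ hy⟩⟩,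
    QWalk.exists_scatA_clm hC θ,
    fun φ p _ => ⟨QWalk.scatteredWave_eq_zero hC θ φ p,
      QWalk.scatteredWave_eq_planeWave hC θ φ p⟩⟩
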